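/- Let $\ell>0$ and let $q\in W^{-1,2}(0,\ell)$, the topological dual of $W^{1,2}_0(0,\ell)$ (all spaces are complex, and $(q|\cdot)$ denotes the linear pairing). For $y\in W^{1,2}(0,\ell)$ let $\mathbf S_q y=-y''+qy$ be the functional on $W^{1,2}_0(0,\ell)$ given by $$(\mathbf S_q y|\phi)=\int_0^\ell y'\phi'\,dx+(q|y\phi).$$ Let $\mathscr D_2(\mathbf S_q)$ be the set of $y\in W^{1,2}(0,\ell)$ for which $\mathbf S_q y$ is a regular distribution with density in $L^2(0,\ell)$. Functions in $W^{1,2}(0,\ell)$ are identified with their continuous representatives on $[0,\ell]$. Assume that $q$ is admissible, that is, there is $f\in\mathscr D_2(\mathbf S_q)$ with $\mathbf S_q f=0$ and $f(x)\neq 0$ for all $x\in[0,\ell]$, and fix such an $f$ normalized by $f(0)=1$. For $y\in\mathscr D_2(\mathbf S_q)$ put $\mathbf D_f y=y'-\frac{f'}{f}y$, which has a continuous representative on $[0,\ell]$. For $\rho\in\mathbb C$ let $e_f(\rho,\cdot)\in \mathscr D_2(\mathbf S_q)$ be the unique solution of $$\mathbf S_q y=\rho^2y,\qquad y(0)=1,\qquad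 \mathbf D_f y(0)=i\rho .$$ Let $\mathcal T_\ell=\{(x,t)\in\mathbb R^2: 0\le x\le \ell,\ |t|\le x\}$. Then, for every $\rho\in\mathbb C$, the solution $e_f(\rho,\cdot)$ exists and is unique, and there exists a function $K_f\in L^2(\mathcal T_\ell)$, independent of $\rho$, such that $K_f(x,\cdot)$ is integrable on $(-x,x)$ for every $x\in(0,\ell)$ and $$e_f(\rho,x)=e^{i\rho x}+\int_{-x}^{x}K_f(x,t)\,e^{i\rho t}\,dt\qquad\text{for all }\rho\in\mathbb C\text{ and all } 0<x<\ell .$$ -/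

import Mathlib

open MeasureTheory Set Topology
open scoped ContDiff Interval

namespace DistributionalSchrodinger

/-! ### Test functions, weak derivatives and the Sobolev space `W^{1,2}(0,ℓ)` -/

/-- `φ ∈ C_0^∞(0,ℓ)`, complex-valued. -/
def IsTestFunction (ℓ : ℝ) (φ : ℝ → ℂ) : Prop :=
  ContDiff ℝ ∞ φ ∧ HasCompactSupport φ ∧ tsupport φ ⊆ Ioo 0 ℓ

/-- `v` is the distributional derivative of `u` on `(0,ℓ)`. -/
def HasWeakDeriv (ℓ : ℝ) (u v : ℝ → ℂ) : Prop :=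
  ∀ φ : ℝ → ℂ, IsTestFunction ℓ φ →
    ∫ x in Ioo 0 ℓ, u x * deriv φ x = -∫ x in Ioo 0 ℓ, v x * φ x

/-- `u ∈ W^{1,2}(0,ℓ)`, where `u` is given through its continuous representative on `[0,ℓ]`
(such a `u` is automatically in `L²(0,ℓ)`). The values of `u` outside `[0,ℓ]` are irrelevant. -/
def MemW12 (ℓ : ℝ) (u : ℝ → ℂ) : Prop :=
  ContinuousOn u (Icc 0 ℓ) ∧
    ∃ v : ℝ → ℂ, MemLp v 2 (volume.restrict (Ioo 0 ℓ)) ∧ HasWeakDeriv ℓ u v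

/-! #### Facts needed to know that `W^{1,2}(0,ℓ)` is stable under sums and products -/

theorem absolutelyContinuous_primitive {ℓ : ℝ} {g : ℝ → ℂ}
    (hg : IntervalIntegrable g volume 0 ℓ) (c : ℂ) :
    AbsolutelyContinuousOnInterval (fun x => c + ∫ t in (0 : ℝ)..x, g t) 0 ℓ := by
  have hn := hg.norm.absolutelyContinuousOnInterval_intervalIntegral (c := 0) (by simp)
  rw [absolutelyContinuousOnInterval_iff] at hn ⊢
  intro ε hε
  obtain ⟨δ, hδ, h⟩ := hn ε hε
  refine ⟨δ, hδ, fun E hE hs => lt_of_le_of_lt (Finset.sum_le_sum fun i hi => ?_) (h E hE hs)⟩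
  have h1 : (E.2 i).1 ∈ uIcc 0 ℓ := (hE.1 i hi).1
  have h2 : (E.2 i).2 ∈ uIcc 0 ℓ := (hE.1 i hi).2
  have i1 : IntervalIntegrable g volume 0 (E.2 i).1 :=
    hg.mono_set (uIcc_subset_uIcc (by simp) h1)
  have i2 : IntervalIntegrable g volume 0 (E.2 i).2 :=
    hg.mono_set (uIcc_subset_uIcc (by simp) h2)
  rw [dist_add_left, dist_comm, dist_comm (∫ t in (0 : ℝ)..(E.2 i).1, ‖g t‖), dist_eq_norm,
    Real.dist_eq, intervalIntegral.integral_interval_sub_left i2 i1,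
    intervalIntegral.integral_interval_sub_left i2.norm i1.norm]
  exact intervalIntegral.norm_integral_le_abs_integral_norm

theorem primitive_mul {ℓ : ℝ} {g h : ℝ → ℂ} (hg : IntervalIntegrable g volume 0 ℓ)
    (hh : IntervalIntegrable h volume 0 ℓ) (a b : ℂ) {x : ℝ} (hx : x ∈ uIcc 0 ℓ) :
    (a + ∫ t in (0 : ℝ)..x, g t) * (b + ∫ t in (0 : ℝ)..x, h t) =
      a * b + ∫ t in (0 : ℝ)..x, (g t * (b + ∫ s in (0 : ℝ)..t, h s) +
        (a + ∫ s in (0 : ℝ)..t, g s) * h t) := by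
  have A := absolutelyContinuous_primitive hg a
  have B := absolutelyContinuous_primitive hh b
  have hk : IntervalIntegrable (fun t => g t * (b + ∫ s in (0 : ℝ)..t, h s) +
      (a + ∫ s in (0 : ℝ)..t, g s) * h t) volume 0 ℓ :=
    (hg.mul_continuousOn B.continuousOn).add (hh.continuousOn_mul A.continuousOn)
  have K := absolutelyContinuous_primitive hk (a * b)
  obtain ⟨C, hC⟩ := ((A.smul B).sub K).const_of_ae_hasDerivAt_zero (by
    filter_upwards [hg.ae_hasDerivAt_integral, hh.ae_hasDerivAt_integral,
      hk.ae_hasDerivAt_integral] with y h1 h2 h3 hy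
    have := (((h1 hy 0 (by simp)).const_add a).mul ((h2 hy 0 (by simp)).const_add b)).sub
      ((h3 hy 0 (by simp)).const_add (a * b))
    convert! this using 1
    ring)
  have e0 := hC 0 (by simp)
  have e1 := hC x hx
  simp at e0 e1
  rw [← e0] at e1
  exact sub_eq_zero.mp e1

theorem memLp_two_intervalIntegrable {ℓ : ℝ} (hℓ : 0 ≤ ℓ) {v : ℝ → ℂ}
    (hv : MemLp v 2 (volume.restrict (Ioo 0 ℓ))) : IntervalIntegrable v volume 0 ℓ := by
  rw [intervalIntegrable_iff_integrableOn_Ioo_of_le hℓ]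
  exact hv.integrable (by norm_num)

theorem IsTestFunction.eq_primitive {ℓ : ℝ} {φ : ℝ → ℂ} (hφ : IsTestFunction ℓ φ) (x : ℝ) :
    φ x = 0 + ∫ t in (0 : ℝ)..x, deriv φ t := by
  have hd : ContDiff ℝ 1 φ := hφ.1.of_le (by exact_mod_cast le_top)
  have h0 : φ 0 = 0 := image_eq_zero_of_notMem_tsupport fun h => by simpa using hφ.2.2 h
  rw [intervalIntegral.integral_deriv_eq_sub (fun y _ => hd.differentiable (by norm_num) y)
    ((hd.continuous_deriv (by norm_num)).intervalIntegrable 0 x)]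
  simp [h0]

theorem hasWeakDeriv_of_primitive {ℓ : ℝ} (hℓ : 0 ≤ ℓ) {u v : ℝ → ℂ} {c : ℂ}
    (hv : IntervalIntegrable v volume 0 ℓ)
    (hu : ∀ x ∈ Icc 0 ℓ, u x = c + ∫ t in (0 : ℝ)..x, v t) : HasWeakDeriv ℓ u v := by
  intro φ hφ
  have hd : ContDiff ℝ 1 φ := hφ.1.of_le (by exact_mod_cast le_top)
  have hI : IntervalIntegrable (deriv φ) volume 0 ℓ :=
    (hd.continuous_deriv (by norm_num)).intervalIntegrable 0 ℓ
  have key := primitive_mul hv hI c 0 (x := ℓ) (by simp)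
  have hl : φ ℓ = 0 := image_eq_zero_of_notMem_tsupport fun h => by simpa using hφ.2.2 h
  simp only [← hφ.eq_primitive] at key
  have A := (absolutelyContinuous_primitive hv c).continuousOn
  rw [intervalIntegral.integral_add (hv.mul_continuousOn hd.continuous.continuousOn)
    (hI.continuousOn_mul A), hl] at key
  have e1 : ∫ x in Ioo 0 ℓ, u x * deriv φ x =
      ∫ t in (0 : ℝ)..ℓ, (c + ∫ s in (0 : ℝ)..t, v s) * deriv φ t := by
    rw [intervalIntegral.integral_of_le hℓ, integral_Ioc_eq_integral_Ioo]
    exact setIntegral_congr_fun measurableSet_Ioo fun x hx => by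
      simp only [hu x (Ioo_subset_Icc_self hx)]
  rw [e1, ← integral_Ioc_eq_integral_Ioo, ← intervalIntegral.integral_of_le hℓ]
  linear_combination -key

theorem isTestFunction_primitive {ℓ : ℝ} {ψ : ℝ → ℝ} (hs : ContDiff ℝ ∞ ψ)
    (hc : HasCompactSupport ψ) (ht : tsupport ψ ⊆ Ioo 0 ℓ) (hz : ∫ x, ψ x = 0) :
    IsTestFunction ℓ (fun x => ((∫ t in (0 : ℝ)..x, ψ t : ℝ) : ℂ)) ∧
      ∀ x, deriv (fun x => ((∫ t in (0 : ℝ)..x, ψ t : ℝ) : ℂ)) x = (ψ x : ℂ) := by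
  have hD : ∀ x, HasDerivAt (fun x => ∫ t in (0 : ℝ)..x, ψ t) (ψ x) x := fun x =>
    intervalIntegral.integral_hasDerivAt_right (hs.continuous.intervalIntegrable _ _)
      (hs.continuous.stronglyMeasurableAtFilter _ _) hs.continuous.continuousAt
  have hsm : ContDiff ℝ ∞ (fun x => ∫ t in (0 : ℝ)..x, ψ t) := by
    rw [contDiff_infty_iff_deriv]
    refine ⟨fun x => (hD x).differentiableAt, ?_⟩
    rwa [show deriv (fun x => ∫ t in (0 : ℝ)..x, ψ t) = ψ from funext fun x => (hD x).deriv]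
  obtain ⟨a, b, hab, hK⟩ : ∃ a b : ℝ, Icc a b ⊆ Ioo 0 ℓ ∧ tsupport ψ ⊆ Icc a b := by
    rcases (tsupport ψ).eq_empty_or_nonempty with h | h
    · exact ⟨1, 0, by simp, by simp [h]⟩
    · have hb := IsCompact.isLeast_sInf hc h
      have hb2 := IsCompact.isGreatest_sSup hc h
      exact ⟨_, _, Icc_subset_Ioo (ht hb.1).1 (ht hb2.1).2, fun x hx => ⟨hb.2 hx, hb2.2 hx⟩⟩
  have hout : ∀ x, x ∉ Icc a b → ψ x = 0 := fun x hx =>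
    image_eq_zero_of_notMem_tsupport fun h => hx (hK h)
  have hzero : ∀ x, x ∉ Icc a b → ∫ t in (0 : ℝ)..x, ψ t = 0 := by
    intro x hx
    by_cases hne : (Icc a b).Nonempty
    · have hab1 : a ≤ b := nonempty_Icc.mp hne
      have h0a : 0 < a := (hab (left_mem_Icc.mpr hab1)).1
      rcases lt_or_ge x a with hxa | hxa
      · rw [intervalIntegral.integral_congr (g := fun _ => (0 : ℝ))]
        · simp
        · intro t ht
          refine hout t fun h => ?_
          have := ht.2
          have h2 := h.1
          rcases le_total 0 x with h3 | h3 <;> simp [h3] at this <;> linarith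
      · have hxb : b < x := by
          by_contra! h
          exact hx ⟨hxa, h⟩
        rw [intervalIntegral.integral_eq_integral_of_support_subset, hz]
        intro t ht
        have : t ∈ Icc a b := by
          by_contra h
          exact ht (hout t h)
        exact ⟨by linarith [this.1], by linarith [this.2]⟩
    · rw [not_nonempty_iff_eq_empty] at hne
      have : ψ = fun _ => 0 := funext fun t => hout t (by simp [hne])
      simp [this]
  have hcs : HasCompactSupport (fun x => ((∫ t in (0 : ℝ)..x, ψ t : ℝ) : ℂ)) :=
    HasCompactSupport.intro (K := Icc a b) isCompact_Icc fun x hx => by simp [hzero x hx]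
  refine ⟨⟨Complex.ofRealCLM.contDiff.comp hsm, hcs, ?_⟩, fun x => (hD x).ofReal_comp.deriv⟩
  refine (closure_minimal (fun x hx => ?_) isClosed_Icc).trans hab
  by_contra h
  exact hx (by simp [hzero x h])

theorem eq_primitive_of_hasWeakDeriv {ℓ : ℝ} (hℓ : 0 < ℓ) {u v : ℝ → ℂ}
    (hu : ContinuousOn u (Icc 0 ℓ)) (hv : IntervalIntegrable v volume 0 ℓ)
    (h : HasWeakDeriv ℓ u v) :
    ∀ x ∈ Icc 0 ℓ, u x = u 0 + ∫ t in (0 : ℝ)..x, v t := by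
  have hP := (absolutelyContinuous_primitive hv 0).continuousOn
  rw [uIcc_of_le hℓ.le] at hP
  have hPw := hasWeakDeriv_of_primitive hℓ.le (u := fun x => 0 + ∫ t in (0 : ℝ)..x, v t)
    (c := 0) hv (fun _ _ => rfl)
  set w : ℝ → ℂ := fun x => u x - (0 + ∫ t in (0 : ℝ)..x, v t) with hw
  have hwc : ContinuousOn w (Icc 0 ℓ) := hu.sub hP
  have intg : ∀ {a k : ℝ → ℂ}, ContinuousOn a (Icc 0 ℓ) → Continuous k →
      IntegrableOn (fun x => a x * k x) (Ioo 0 ℓ) := fun ha hk =>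
    ((ha.mul hk.continuousOn).integrableOn_Icc).mono_set Ioo_subset_Icc_self
  have hw0 : ∀ φ, IsTestFunction ℓ φ → ∫ x in Ioo 0 ℓ, w x * deriv φ x = 0 := by
    intro φ hφ
    have hd : Continuous (deriv φ) :=
      (hφ.1.of_le (by exact_mod_cast le_top : (1 : WithTop ℕ∞) ≤ ∞)).continuous_deriv
        (by norm_num)
    simp only [hw, sub_mul]
    rw [integral_sub (intg hu hd) (intg hP hd), h φ hφ, hPw φ hφ, sub_self]
  let B : ContDiffBump (ℓ / 2) := ⟨ℓ / 8, ℓ / 4, by positivity, by linarith⟩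
  let η : ℝ → ℝ := B.normed volume
  have hη : ContDiff ℝ ∞ η := B.contDiff_normed
  have hηc : HasCompactSupport η := B.hasCompactSupport_normed
  have hηt : tsupport η ⊆ Ioo 0 ℓ := by
    rw [B.tsupport_normed_eq, Real.closedBall_eq_Icc]
    exact Icc_subset_Ioo (by simp only [B]; linarith) (by simp only [B]; linarith)
  have hη1 : ∫ x, η x = 1 := B.integral_normed
  set c : ℂ := ∫ x in Ioo 0 ℓ, w x * (η x : ℂ) with hc
  have hae : ∀ᵐ x, x ∈ Ioo 0 ℓ → w x - c = 0 := by
    refine isOpen_Ioo.ae_eq_zero_of_integral_contDiff_smul_eq_zero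
      (((hwc.sub continuousOn_const).integrableOn_Icc).mono_set
        Ioo_subset_Icc_self).locallyIntegrableOn ?_
    intro g hg hgc hgt
    set m : ℝ := ∫ x, g x with hm
    have hψt : tsupport (fun x => g x - m * η x) ⊆ Ioo 0 ℓ := by
      refine (tsupport_sub _ _).trans (union_subset hgt ?_)
      exact (closure_mono (Function.support_mul_subset_right _ _)).trans hηt
    have hψc : HasCompactSupport (fun x => g x - m * η x) := hgc.sub hηc.mul_left
    have hψz : ∫ x, (g x - m * η x) = 0 := by
      rw [integral_sub (hg.continuous.integrable_of_hasCompactSupport hgc)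
        ((hη.continuous.integrable_of_hasCompactSupport hηc).const_mul m),
        integral_const_mul, hη1]
      simp [hm]
    obtain ⟨hT, hTd⟩ := isTestFunction_primitive (hg.sub (contDiff_const.mul hη)) hψc hψt hψz
    have e := hw0 _ hT
    simp only [hTd] at e
    have hgI : Continuous fun x => (g x : ℂ) := Complex.continuous_ofReal.comp hg.continuous
    have hηI : Continuous fun x => (η x : ℂ) := Complex.continuous_ofReal.comp hη.continuous
    have e2 : ∫ x in Ioo 0 ℓ, w x * (g x : ℂ) = m * c := by
      have : ∀ x, w x * ((g x - m * η x : ℝ) : ℂ) = w x * g x - m * (w x * η x) := by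
        intro x
        push_cast
        ring
      simp only [this] at e
      rw [integral_sub (intg hwc hgI) ((intg hwc hηI).const_mul _), integral_const_mul] at e
      exact sub_eq_zero.mp e
    have e3 : ∫ x in Ioo 0 ℓ, (g x : ℂ) = m := by
      rw [integral_complex_ofReal, setIntegral_eq_integral_of_forall_compl_eq_zero]
      exact fun x hx => image_eq_zero_of_notMem_tsupport fun hh => hx (hgt hh)
    have e4 : ∫ x, g x • (w x - c) = ∫ x in Ioo 0 ℓ, (w x * (g x : ℂ) - c * (g x : ℂ)) := by
      rw [← setIntegral_eq_integral_of_forall_compl_eq_zero (s := Ioo 0 ℓ)]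
      · congr 1
        ext x
        simp only [Complex.real_smul]
        ring
      · intro x hx
        rw [image_eq_zero_of_notMem_tsupport fun hh => hx (hgt hh), zero_smul]
    rw [e4, integral_sub (intg hwc hgI) ((intg continuousOn_const hgI)), e2,
      integral_const_mul, e3]
    ring
  have hEq : EqOn w (fun _ => c) (Icc 0 ℓ) := by
    refine Measure.eqOn_Icc_of_ae_eq volume hℓ.ne ?_ hwc continuousOn_const
    rw [← restrict_Ioo_eq_restrict_Icc]
    refine (ae_restrict_iff' measurableSet_Ioo).2 ?_
    filter_upwards [hae] with x hx hxm
    exact sub_eq_zero.mp (hx hxm)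
  intro x hx
  have e1 := hEq hx
  have e0 := hEq (left_mem_Icc.mpr hℓ.le)
  simp [hw] at e1 e0
  rw [e0]
  linear_combination e1

theorem memW12_of_primitive {ℓ : ℝ} (hℓ : 0 ≤ ℓ) {u v : ℝ → ℂ} {c : ℂ}
    (hv : MemLp v 2 (volume.restrict (Ioo 0 ℓ)))
    (hu : ∀ x ∈ Icc 0 ℓ, u x = c + ∫ t in (0 : ℝ)..x, v t) : MemW12 ℓ u := by
  have hI := memLp_two_intervalIntegrable hℓ hv
  have hP := (absolutelyContinuous_primitive hI c).continuousOn
  rw [uIcc_of_le hℓ] at hP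
  exact ⟨hP.congr hu, v, hv, hasWeakDeriv_of_primitive hℓ hI hu⟩

theorem MemW12.exists_primitive {ℓ : ℝ} (hℓ : 0 < ℓ) {u : ℝ → ℂ} (hu : MemW12 ℓ u) :
    ∃ v : ℝ → ℂ, MemLp v 2 (volume.restrict (Ioo 0 ℓ)) ∧
      ∀ x ∈ Icc 0 ℓ, u x = u 0 + ∫ t in (0 : ℝ)..x, v t := by
  obtain ⟨hc, v, hv, hw⟩ := hu
  exact ⟨v, hv, eq_primitive_of_hasWeakDeriv hℓ hc (memLp_two_intervalIntegrable hℓ.le hv) hw⟩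

theorem memW12_of_nonpos {ℓ : ℝ} (hℓ : ℓ ≤ 0) {u : ℝ → ℂ} (hu : ContinuousOn u (Icc 0 ℓ)) :
    MemW12 ℓ u :=
  ⟨hu, 0, by simp, fun φ _ => by simp [Ioo_eq_empty (not_lt.mpr hℓ)]⟩

theorem MemW12.add {ℓ : ℝ} {u w : ℝ → ℂ} (hu : MemW12 ℓ u) (hw : MemW12 ℓ w) :
    MemW12 ℓ (u + w) := by
  rcases le_or_gt ℓ 0 with hℓ | hℓ
  · exact memW12_of_nonpos hℓ (hu.1.add hw.1)
  obtain ⟨v, hv, h1⟩ := hu.exists_primitive hℓ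
  obtain ⟨z, hz, h2⟩ := hw.exists_primitive hℓ
  refine memW12_of_primitive hℓ.le (v := v + z) (c := u 0 + w 0) (hv.add hz) fun x hx => ?_
  have sub : uIcc 0 x ⊆ uIcc 0 ℓ := uIcc_subset_uIcc (by simp) (by rwa [uIcc_of_le hℓ.le])
  have e := intervalIntegral.integral_add
    ((memLp_two_intervalIntegrable hℓ.le hv).mono_set sub)
    ((memLp_two_intervalIntegrable hℓ.le hz).mono_set sub)
  simp only [Pi.add_apply]
  rw [e, h1 x hx, h2 x hx]
  ring

theorem MemW12.const_smul {ℓ : ℝ} {u : ℝ → ℂ} (a : ℂ) (hu : MemW12 ℓ u) :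
    MemW12 ℓ (a • u) := by
  rcases le_or_gt ℓ 0 with hℓ | hℓ
  · exact memW12_of_nonpos hℓ (hu.1.const_smul a)
  obtain ⟨v, hv, h1⟩ := hu.exists_primitive hℓ
  refine memW12_of_primitive hℓ.le (v := a • v) (c := a * u 0) (hv.const_smul a)
    fun x hx => ?_
  simp only [Pi.smul_apply, smul_eq_mul, intervalIntegral.integral_const_mul]
  rw [h1 x hx]
  ring

theorem MemW12.mul {ℓ : ℝ} {u w : ℝ → ℂ} (hu : MemW12 ℓ u) (hw : MemW12 ℓ w) :
    MemW12 ℓ (u * w) := by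
  rcases le_or_gt ℓ 0 with hℓ | hℓ
  · exact memW12_of_nonpos hℓ (hu.1.mul hw.1)
  obtain ⟨v, hv, h1⟩ := hu.exists_primitive hℓ
  obtain ⟨z, hz, h2⟩ := hw.exists_primitive hℓ
  have hvI := memLp_two_intervalIntegrable hℓ.le hv
  have hzI := memLp_two_intervalIntegrable hℓ.le hz
  have bdd : ∀ {a k : ℝ → ℂ}, ContinuousOn a (Icc 0 ℓ) →
      MemLp k 2 (volume.restrict (Ioo 0 ℓ)) →
      MemLp (fun x => a x * k x) 2 (volume.restrict (Ioo 0 ℓ)) := by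
    intro a k ha hk
    obtain ⟨C, hC⟩ := isCompact_Icc.exists_bound_of_continuousOn ha
    refine MemLp.of_le_mul (c := C) hk (AEStronglyMeasurable.mul
      ((ha.mono Ioo_subset_Icc_self).aestronglyMeasurable measurableSet_Ioo) hk.1) ?_
    filter_upwards [ae_restrict_mem measurableSet_Ioo] with x hx
    rw [norm_mul]
    exact mul_le_mul_of_nonneg_right (hC x (Ioo_subset_Icc_self hx)) (norm_nonneg _)
  refine memW12_of_primitive hℓ.le (v := fun x => w x * v x + u x * z x) (c := u 0 * w 0)
    ((bdd hw.1 hv).add (bdd hu.1 hz)) fun x hx => ?_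
  rw [Pi.mul_apply, h1 x hx, h2 x hx,
    primitive_mul hvI hzI (u 0) (w 0) (by rwa [uIcc_of_le hℓ.le])]
  congr 1
  refine intervalIntegral.integral_congr fun t ht => ?_
  rw [uIcc_of_le hx.1] at ht
  have ht2 : t ∈ Icc 0 ℓ := ⟨ht.1, ht.2.trans hx.2⟩
  rw [← h1 t ht2, ← h2 t ht2]
  ring

/-! ### The spaces `W^{1,2}`, `W_0^{1,2}` and `W^{-1,2}` -/

/-- The Sobolev space `W^{1,2}(0,ℓ)` (elements are continuous representatives). -/
def W12 (ℓ : ℝ) : Submodule ℂ (ℝ → ℂ) where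
  carrier := {u | MemW12 ℓ u}
  add_mem' := MemW12.add
  zero_mem' := ⟨continuousOn_const, 0, by simp, fun φ _ => by simp⟩
  smul_mem' := fun a _ hu => MemW12.const_smul a hu

/-- The weak derivative `u'` in `L²(0,ℓ)` of `u ∈ W^{1,2}(0,ℓ)`; it is unique up to
equality almost everywhere on `(0,ℓ)`. -/
noncomputable def weakDeriv {ℓ : ℝ} (u : W12 ℓ) : ℝ → ℂ :=
  Classical.choose u.2.2

/-- The norm of `W^{1,2}(0,ℓ)`. -/
noncomputable def sobolevNorm {ℓ : ℝ} (u : W12 ℓ) : ℝ :=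
  Real.sqrt ((∫ x in Ioo 0 ℓ, ‖u.1 x‖ ^ 2) + ∫ x in Ioo 0 ℓ, ‖weakDeriv u x‖ ^ 2)

/-- `W_0^{1,2}(0,ℓ)`: the functions in `W^{1,2}(0,ℓ)` that vanish on the boundary `{0, ℓ}`. -/
def W12Zero (ℓ : ℝ) : Submodule ℂ (W12 ℓ) where
  carrier := {u | u.1 0 = 0 ∧ u.1 ℓ = 0}
  add_mem' := fun {u w} hu hw => by
    constructor
    · simpa [hu.1] using hw.1
    · simpa [hu.2] using hw.2
  zero_mem' := ⟨rfl, rfl⟩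
  smul_mem' := fun a u hu => by
    constructor
    · simpa using Or.inr hu.1
    · simpa using Or.inr hu.2

/-- The product `y φ ∈ W_0^{1,2}(0,ℓ)` of `y ∈ W^{1,2}(0,ℓ)` and `φ ∈ W_0^{1,2}(0,ℓ)`. -/
def mulZero {ℓ : ℝ} (y : W12 ℓ) (φ : W12Zero ℓ) : W12Zero ℓ :=
  ⟨⟨fun x => y.1 x * φ.1.1 x, MemW12.mul y.2 φ.1.2⟩,
    by simp [φ.2.1], by simp [φ.2.2]⟩

/-- `W^{-1,2}(0,ℓ)`: the bounded linear functionals on `W_0^{1,2}(0,ℓ)`. The pairing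
`(q|φ)` is `q.toFunctional φ`. -/
structure WNeg12 (ℓ : ℝ) where
  toFunctional : W12Zero ℓ →ₗ[ℂ] ℂ
  bounded : ∃ C : ℝ, ∀ φ : W12Zero ℓ, ‖toFunctional φ‖ ≤ C * sobolevNorm φ.1

/-! ### The Schrödinger operator with a distributional potential -/

/-- `S_q y = -y'' + q y` as a distribution: `(S_q y|φ) = ∫ y' φ' + (q|y φ)`. -/
noncomputable def schrodinger {ℓ : ℝ} (q : WNeg12 ℓ) (y : W12 ℓ) (φ : W12Zero ℓ) : ℂ :=
  (∫ x in Ioo 0 ℓ, weakDeriv y x * weakDeriv φ.1 x) + q.toFunctional (mulZero y φ)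

/-- The domain of `L²`-regularization of `S_q`: `S_q y` is an `L²`-regular distribution. -/
def InRegularizationDomain {ℓ : ℝ} (q : WNeg12 ℓ) (y : W12 ℓ) : Prop :=
  ∃ g : ℝ → ℂ, MemLp g 2 (volume.restrict (Ioo 0 ℓ)) ∧
    ∀ φ : W12Zero ℓ, IsTestFunction ℓ φ.1.1 →
      schrodinger q y φ = ∫ x in Ioo 0 ℓ, g x * φ.1.1 x

/-- `y` is a solution of `-y'' + q y = lam y`, that is, `S_q y = lam y` in `W^{-1,2}(0,ℓ)`. -/
def IsSolution {ℓ : ℝ} (q : WNeg12 ℓ) (lam : ℂ) (y : W12 ℓ) : Prop :=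
  InRegularizationDomain q y ∧
    ∀ φ : W12Zero ℓ, schrodinger q y φ = lam * ∫ x in Ioo 0 ℓ, y.1 x * φ.1.1 x

/-- `f` is a solution of `S_q f = 0` without zeros in the closed interval `[0,ℓ]`. A potential
`q` is admissible if such an `f` exists. -/
def IsNonvanishingSolution {ℓ : ℝ} (q : WNeg12 ℓ) (f : W12 ℓ) : Prop :=
  IsSolution q 0 f ∧ ∀ x ∈ Icc 0 ℓ, f.1 x ≠ 0

/-- `D_f y = y' - (f'/f) y`, an element of `L²(0,ℓ)`. -/
noncomputable def darbouxDeriv {ℓ : ℝ} (f y : W12 ℓ) : ℝ → ℂ :=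
  fun x => weakDeriv y x - weakDeriv f x / f.1 x * y.1 x

/-- `D_f y` has a continuous representative on `[0,ℓ]` whose value at `0` is `a`. (If `y` is in
the domain of `L²`-regularization, then `D_f y ∈ W^{1,2}(0,ℓ)`, so it has one.) -/
def DarbouxDerivAtZero {ℓ : ℝ} (f y : W12 ℓ) (a : ℂ) : Prop :=
  ∃ w : ℝ → ℂ, ContinuousOn w (Icc 0 ℓ) ∧
    w =ᵐ[volume.restrict (Ioo 0 ℓ)] darbouxDeriv f y ∧ w 0 = a

/-- `y` is the solution `e_f(ρ,·)` of `-y'' + q y = ρ² y` with initial conditions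
`y(0) = 1`, `D_f y(0) = i ρ`. -/
def IsExponentialSolution {ℓ : ℝ} (q : WNeg12 ℓ) (f : W12 ℓ) (ρ : ℂ) (y : W12 ℓ) : Prop :=
  IsSolution q (ρ ^ 2) y ∧ y.1 0 = 1 ∧ DarbouxDerivAtZero f y (Complex.I * ρ)

/-- The triangle `𝒯_ℓ = {(x,t) : 0 ≤ x ≤ ℓ, |t| ≤ x}`. -/
def triangle (ℓ : ℝ) : Set (ℝ × ℝ) :=
  {p | 0 ≤ p.1 ∧ p.1 ≤ ℓ ∧ |p.2| ≤ p.1}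

end DistributionalSchrodinger

/-! Put σ = f'/f, which lies in L²(0,ℓ). Testing S_q f = 0 with yφ/f eliminates q: the form (S_q
y|φ) becomes ∫ (y' - σy)(φ' - σφ) (`schrodinger_eq_integral_darbouxDeriv`). Formally S_q = -(d/dx +
σ)(d/dx - σ), and with D_f y = iρz the equation S_q y = ρ²y is the Dirac system y' = σy + iρz, z' =
iρy - σz, y(0) = z(0) = 1, whose only coefficient is an L² function.

In the variables y = a + b, z = a - b the system reads a' = iρa + σb, b' = -iρb + σa, with a(0) = 1,
b(0) = 0. One looks for a = e^{iρx} + ∫ K₁(x,t) e^{iρt} dt and b = ∫ K₂(x,t) e^{iρt} dt. Since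
multiplication by e^{±iρ(x-s)} is a translation in t, the Duhamel formulas are the transforms of
equations free of ρ: K₁(x,t) = ∫_0^x σ(s) K₂(s, t-(x-s)) ds and K₂(x,t) = ½σ((x+t)/2) 1_{|t|<x} +
∫_0^x σ(s) K₁(s, t+(x-s)) ds. Successive approximations converge geometrically in an exponentially
weighted norm (`exists_exp_weight`, `exists_kernel_bound`); everything after the zeroth term is
locally bounded, and the zeroth term is square integrable. The kernel sought is K₁ + K₂.

`dirac_kernelTransform` and `isExponentialSolution_of_dirac` transfer this back to existence.
Conversely, `IsExponentialSolution.exists_system` turns any exponential solution into a first order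
system, and a Gronwall argument gives uniqueness (`IsExponentialSolution.eqOn`). -/

namespace DistributionalSchrodinger

/-! ### A weighted integral inequality and Gronwall's lemma for `L²` coefficients -/

/-- Makes Volterra operators with an L² coefficient contractions in a weighted sup norm. Young's
inequality bounds the integral by (Q/(2λ) + 1/4) e^{λx} with Q = ∫ g², and λ = 1 + Q makes the
bracket at most 3/4. -/
theorem exists_exp_weight {g : ℝ → ℝ} (hg0 : ∀ s, 0 ≤ g s) (hg : MemLp g 2 volume) :
    ∃ lam > 0, ∃ θ : ℝ, 0 ≤ θ ∧ θ < 1 ∧ ∀ x : ℝ,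
      IntegrableOn (fun s => g s * Real.exp (lam * s)) (Iic x) ∧
        ∫ s in Iic x, g s * Real.exp (lam * s) ≤ θ * Real.exp (lam * x) := by
  have hsq : Integrable (fun s => g s ^ 2) := hg.integrable_sq
  set Q : ℝ := ∫ s, g s ^ 2 with hQ
  have hQ0 : 0 ≤ Q := integral_nonneg fun s => sq_nonneg _
  set lam : ℝ := 1 + Q with hlam
  have hl : 0 < lam := by positivity
  refine ⟨lam, hl, 3 / 4, by norm_num, by norm_num, fun x => ?_⟩
  set b : ℝ → ℝ := fun s => Real.exp (lam * x) / (2 * lam) * g s ^ 2 +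
    lam / 2 * Real.exp (-(lam * x)) * Real.exp (2 * lam * s) with hb
  have hle : ∀ s, g s * Real.exp (lam * s) ≤ b s := by
    intro s
    have e1 : Real.exp (2 * lam * s) = Real.exp (lam * s) ^ 2 := by
      rw [← Real.exp_nat_mul]; congr 1; push_cast; ring
    rw [hb]
    simp only
    rw [e1, Real.exp_neg]
    have hE := Real.exp_pos (lam * x)
    set E := Real.exp (lam * x)
    set u := Real.exp (lam * s)
    have : E / (2 * lam) * g s ^ 2 + lam / 2 * E⁻¹ * u ^ 2 - g s * u =
        (E * g s - lam * u) ^ 2 / (2 * lam * E) := by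
      field_simp
      ring
    have h2 : 0 ≤ (E * g s - lam * u) ^ 2 / (2 * lam * E) := by positivity
    linarith
  have hI1 : IntegrableOn (fun s => Real.exp (lam * x) / (2 * lam) * g s ^ 2) (Iic x) :=
    (hsq.const_mul _).integrableOn
  have hI2 : IntegrableOn (fun s => lam / 2 * Real.exp (-(lam * x)) *
      Real.exp (2 * lam * s)) (Iic x) :=
    (integrableOn_exp_mul_Iic (by positivity) x).const_mul _
  have hbI : IntegrableOn b (Iic x) := hI1.add hI2
  have hgI : IntegrableOn (fun s => g s * Real.exp (lam * s)) (Iic x) := by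
    refine Integrable.mono' hbI ?_ (Filter.Eventually.of_forall fun s => ?_)
    · exact (hg.1.mul (by fun_prop)).restrict
    · rw [Real.norm_of_nonneg (mul_nonneg (hg0 s) (Real.exp_pos _).le)]
      exact hle s
  refine ⟨hgI, (setIntegral_mono hgI hbI hle).trans ?_⟩
  rw [hb, integral_add hI1 hI2, integral_const_mul, integral_const_mul,
    integral_exp_mul_Iic (by positivity)]
  have h1 : ∫ s in Iic x, g s ^ 2 ≤ Q :=
    setIntegral_le_integral hsq (Filter.Eventually.of_forall fun s => sq_nonneg _)
  have e2 : Real.exp (2 * lam * x) = Real.exp (lam * x) * Real.exp (lam * x) := by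
    rw [← Real.exp_add]; congr 1; ring
  rw [e2, Real.exp_neg]
  have hE := Real.exp_pos (lam * x)
  set E := Real.exp (lam * x)
  calc _ ≤ E / (2 * lam) * lam + lam / 2 * E⁻¹ * (E * E / (2 * lam)) := by
        gcongr
        linarith
    _ = 3 / 4 * E := by field_simp; ring

/-- If m is the maximum of u(x) e^{-λx}, the hypothesis at a maximum point yields m ≤ θm with θ < 1,
hence m = 0. -/
theorem eq_zero_of_le_integral_mul {ℓ : ℝ} (hℓ : 0 < ℓ) {g u : ℝ → ℝ} (hg0 : ∀ s, 0 ≤ g s)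
    (hg : MemLp g 2 (volume.restrict (Ioo 0 ℓ))) (hu : ContinuousOn u (Icc 0 ℓ))
    (hu0 : ∀ x ∈ Icc 0 ℓ, 0 ≤ u x)
    (h : ∀ x ∈ Icc 0 ℓ, u x ≤ ∫ s in (0 : ℝ)..x, g s * u s) :
    ∀ x ∈ Icc 0 ℓ, u x = 0 := by
  obtain ⟨lam, -, θ, hθ0, hθ1, hw⟩ := exists_exp_weight (g := (Ioo 0 ℓ).indicator g)
    (fun s => indicator_nonneg (fun s _ => hg0 s) s) ((memLp_indicator_iff_restrict
      measurableSet_Ioo).2 hg)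
  have hvc : ContinuousOn (fun s => u s * Real.exp (-(lam * s))) (Icc 0 ℓ) :=
    hu.mul (by fun_prop)
  obtain ⟨x₀, hx₀, hmax⟩ := isCompact_Icc.exists_isMaxOn (nonempty_Icc.2 hℓ.le) hvc
  set m := u x₀ * Real.exp (-(lam * x₀)) with hm
  have hm0 : 0 ≤ m := mul_nonneg (hu0 _ hx₀) (Real.exp_pos _).le
  have hle : ∀ s ∈ Icc 0 ℓ, u s ≤ m * Real.exp (lam * s) := by
    intro s hs
    have := hmax hs
    simp only [mem_ofPred_eq] at this
    rw [Real.exp_neg, ← div_eq_mul_inv, div_le_iff₀ (Real.exp_pos _)] at this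
    exact this
  have hkey : u x₀ ≤ m * (θ * Real.exp (lam * x₀)) := by
    refine (h x₀ hx₀).trans ?_
    rw [intervalIntegral.integral_of_le hx₀.1, integral_Ioc_eq_integral_Ioo]
    have hs1 : Ioo 0 x₀ ⊆ Ioo 0 ℓ := Ioo_subset_Ioo_right hx₀.2
    calc ∫ s in Ioo 0 x₀, g s * u s
        ≤ ∫ s in Ioo 0 x₀, m * ((Ioo 0 ℓ).indicator g s * Real.exp (lam * s)) := by
          refine setIntegral_mono_on ?_ ?_ measurableSet_Ioo fun s hs => ?_
          · have h1 : IntegrableOn g (Icc 0 ℓ) := by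
              rw [integrableOn_Icc_iff_integrableOn_Ioo]
              exact hg.integrable (by norm_num)
            exact (h1.mul_continuousOn hu isCompact_Icc).mono_set
              (hs1.trans Ioo_subset_Icc_self)
          · exact ((hw x₀).1.mono_set fun s hs => hs.2.le).const_mul m
          · rw [indicator_of_mem (hs1 hs)]
            have := mul_le_mul_of_nonneg_left (hle s (Ioo_subset_Icc_self (hs1 hs))) (hg0 s)
            linarith
      _ ≤ ∫ s in Iic x₀, m * ((Ioo 0 ℓ).indicator g s * Real.exp (lam * s)) := by
          refine setIntegral_mono_set ((hw x₀).1.const_mul m)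
            (Filter.Eventually.of_forall fun s => ?_)
            (Filter.Eventually.of_forall fun s hs => hs.2.le)
          exact mul_nonneg hm0 (mul_nonneg (indicator_nonneg (fun s _ => hg0 s) s)
            (Real.exp_pos _).le)
      _ ≤ _ := by
          rw [integral_const_mul]
          exact mul_le_mul_of_nonneg_left (hw x₀).2 hm0
  have hmz : m = 0 := by
    have e : m * Real.exp (lam * x₀) = u x₀ := by
      rw [hm, mul_assoc, ← Real.exp_add]; simp
    have hE := Real.exp_pos (lam * x₀)
    have h3 : m * Real.exp (lam * x₀) ≤ θ * m * Real.exp (lam * x₀) := by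
      rw [e]; linarith
    have h4 : m ≤ θ * m := le_of_mul_le_mul_right h3 hE
    nlinarith
  intro x hx
  have := hle x hx
  rw [hmz, zero_mul] at this
  exact le_antisymm this (hu0 x hx)

/-! ### Weak derivatives -/

theorem memLp_weakDeriv {ℓ : ℝ} (u : W12 ℓ) :
    MemLp (weakDeriv u) 2 (volume.restrict (Ioo 0 ℓ)) :=
  (Classical.choose_spec u.2.2).1

theorem eq_integral_weakDeriv {ℓ : ℝ} (hℓ : 0 < ℓ) (u : W12 ℓ) :
    ∀ x ∈ Icc 0 ℓ, u.1 x = u.1 0 + ∫ t in (0 : ℝ)..x, weakDeriv u t :=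
  eq_primitive_of_hasWeakDeriv hℓ u.2.1 (memLp_two_intervalIntegrable hℓ.le (memLp_weakDeriv u))
    (Classical.choose_spec u.2.2).2

theorem ae_hasDerivAt_of_primitive {ℓ : ℝ} (hℓ : 0 < ℓ) {u v : ℝ → ℂ} {c : ℂ}
    (hv : IntervalIntegrable v volume 0 ℓ)
    (hu : ∀ x ∈ Icc 0 ℓ, u x = c + ∫ t in (0 : ℝ)..x, v t) :
    ∀ᵐ x ∂volume.restrict (Ioo 0 ℓ), HasDerivAt u (v x) x := by
  refine (ae_restrict_iff' measurableSet_Ioo).2 ?_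
  filter_upwards [hv.ae_hasDerivAt_integral] with x hx hxm
  have h1 := (hx (by rw [uIcc_of_le hℓ.le]; exact Ioo_subset_Icc_self hxm) 0 (by simp)).const_add c
  refine h1.congr_of_eventuallyEq ?_
  filter_upwards [isOpen_Ioo.mem_nhds hxm] with y hy
  exact hu y (Ioo_subset_Icc_self hy)

theorem ae_hasDerivAt_weakDeriv {ℓ : ℝ} (hℓ : 0 < ℓ) (u : W12 ℓ) :
    ∀ᵐ x ∂volume.restrict (Ioo 0 ℓ), HasDerivAt u.1 (weakDeriv u x) x :=
  ae_hasDerivAt_of_primitive hℓ (memLp_two_intervalIntegrable hℓ.le (memLp_weakDeriv u))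
    (eq_integral_weakDeriv hℓ u)

/-- `weakDeriv` is an arbitrary choice; it is identified by comparing both candidates with the
classical derivative, which exists almost everywhere. -/
theorem weakDeriv_ae_eq_of_primitive {ℓ : ℝ} (hℓ : 0 < ℓ) (u : W12 ℓ) {v : ℝ → ℂ} {c : ℂ}
    (hv : IntervalIntegrable v volume 0 ℓ)
    (hu : ∀ x ∈ Icc 0 ℓ, u.1 x = c + ∫ t in (0 : ℝ)..x, v t) :
    weakDeriv u =ᵐ[volume.restrict (Ioo 0 ℓ)] v := by
  filter_upwards [ae_hasDerivAt_weakDeriv hℓ u, ae_hasDerivAt_of_primitive hℓ hv hu] with x h1 h2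
  exact h1.unique h2

theorem memLp_continuousOn_mul {ℓ : ℝ} {a v : ℝ → ℂ} (ha : ContinuousOn a (Icc 0 ℓ))
    (hv : MemLp v 2 (volume.restrict (Ioo 0 ℓ))) :
    MemLp (fun x => a x * v x) 2 (volume.restrict (Ioo 0 ℓ)) := by
  obtain ⟨C, hC⟩ := isCompact_Icc.exists_bound_of_continuousOn ha
  refine MemLp.of_le_mul (c := C) hv (AEStronglyMeasurable.mul
    ((ha.mono Ioo_subset_Icc_self).aestronglyMeasurable measurableSet_Ioo) hv.1) ?_
  filter_upwards [ae_restrict_mem measurableSet_Ioo] with x hx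
  rw [norm_mul]
  exact mul_le_mul_of_nonneg_right (hC x (Ioo_subset_Icc_self hx)) (norm_nonneg _)

theorem memLp_continuousOn {ℓ : ℝ} {a : ℝ → ℂ} (ha : ContinuousOn a (Icc 0 ℓ)) :
    MemLp a 2 (volume.restrict (Ioo 0 ℓ)) := by
  simpa using memLp_continuousOn_mul ha (memLp_const (1 : ℂ))

theorem uIcc_subset_of_mem {ℓ x : ℝ} (hx : x ∈ Icc 0 ℓ) : uIcc 0 x ⊆ uIcc 0 ℓ :=
  uIcc_subset_uIcc (by simp) (by rwa [uIcc_of_le (hx.1.trans hx.2)])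

/-- A zero-free function in `W^{1,2}` has its inverse in `W^{1,2}`. -/
theorem memW12_inv {ℓ : ℝ} (hℓ : 0 < ℓ) (f : W12 ℓ) (hf : ∀ x ∈ Icc 0 ℓ, f.1 x ≠ 0) :
    MemW12 ℓ (fun x => (f.1 x)⁻¹) := by
  have hfi : ContinuousOn (fun x => (f.1 x)⁻¹) (Icc 0 ℓ) := f.2.1.inv₀ hf
  set v : ℝ → ℂ := fun x => -((f.1 x)⁻¹ * (f.1 x)⁻¹) * weakDeriv f x with hv
  have hvL : MemLp v 2 (volume.restrict (Ioo 0 ℓ)) :=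
    memLp_continuousOn_mul (hfi.mul hfi).neg (memLp_weakDeriv f)
  have hvI := memLp_two_intervalIntegrable hℓ.le hvL
  have hwI := memLp_two_intervalIntegrable hℓ.le (memLp_weakDeriv f)
  set σ : ℝ → ℂ := fun x => (f.1 x)⁻¹ * weakDeriv f x with hσ
  have hσL : MemLp σ 2 (volume.restrict (Ioo 0 ℓ)) :=
    memLp_continuousOn_mul hfi (memLp_weakDeriv f)
  -- h is the primitive of the formal derivative -f'/f² of 1/f. The defect fh - 1 solves a
  -- homogeneous Volterra equation with coefficient σ, so Gronwall forces h = 1/f.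
  set h : ℝ → ℂ := fun x => (f.1 0)⁻¹ + ∫ t in (0 : ℝ)..x, v t with hh
  have hhc : ContinuousOn h (Icc 0 ℓ) := by
    have := (absolutelyContinuous_primitive hvI (f.1 0)⁻¹).continuousOn
    rwa [uIcc_of_le hℓ.le] at this
  have hd : ∀ x ∈ Icc 0 ℓ, f.1 x * h x - 1 =
      ∫ t in (0 : ℝ)..x, σ t * (f.1 t * h t - 1) := by
    intro x hx
    have key := primitive_mul hwI hvI (f.1 0) (f.1 0)⁻¹ (x := x) (by rwa [uIcc_of_le hℓ.le])
    rw [← eq_integral_weakDeriv hℓ f x hx] at key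
    rw [hh, key, mul_inv_cancel₀ (hf 0 (left_mem_Icc.2 hℓ.le)), add_sub_cancel_left]
    refine intervalIntegral.integral_congr fun t ht => ?_
    rw [uIcc_of_le hx.1] at ht
    have ht2 : t ∈ Icc 0 ℓ := ⟨ht.1, ht.2.trans hx.2⟩
    have hft := hf t ht2
    rw [← eq_integral_weakDeriv hℓ f t ht2, hσ, hv]
    field_simp
    ring
  have hzero := eq_zero_of_le_integral_mul hℓ (g := fun s => ‖σ s‖)
    (u := fun s => ‖f.1 s * h s - 1‖) (fun s => norm_nonneg _) hσL.norm
    ((f.2.1.mul hhc).sub continuousOn_const).norm (fun x _ => norm_nonneg _) (fun x hx => by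
      rw [hd x hx]
      refine (intervalIntegral.norm_integral_le_integral_norm hx.1).trans_eq ?_
      simp only [norm_mul])
  refine memW12_of_primitive hℓ.le (c := (f.1 0)⁻¹) hvL fun x hx => ?_
  have h1 := sub_eq_zero.1 (norm_eq_zero.1 (hzero x hx))
  exact inv_eq_of_mul_eq_one_right h1

/-- Elements of `W12Zero` are functions on all of ℝ. Boundedness of q kills differences that vanish
on [0,ℓ], because their Sobolev norm is zero. -/
theorem toFunctional_congr {ℓ : ℝ} (hℓ : 0 < ℓ) (q : WNeg12 ℓ) {φ ψ : W12Zero ℓ}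
    (h : ∀ x ∈ Icc 0 ℓ, φ.1.1 x = ψ.1.1 x) : q.toFunctional φ = q.toFunctional ψ := by
  rw [← sub_eq_zero, ← map_sub]
  obtain ⟨C, hC⟩ := q.bounded
  have hz : ∀ x ∈ Icc 0 ℓ, (φ - ψ).1.1 x = 0 := fun x hx => by simp [h x hx]
  generalize φ - ψ = δ at hz ⊢
  have hw : weakDeriv δ.1 =ᵐ[volume.restrict (Ioo 0 ℓ)] fun _ => 0 :=
    weakDeriv_ae_eq_of_primitive hℓ _ (c := 0) (by simp) (fun x hx => by simp [hz x hx])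
  have hn : sobolevNorm δ.1 = 0 := by
    have e1 : ∫ x in Ioo 0 ℓ, ‖δ.1.1 x‖ ^ 2 = 0 :=
      setIntegral_eq_zero_of_forall_eq_zero fun x hx => by
        simp [hz x (Ioo_subset_Icc_self hx)]
    have e2 : ∫ x in Ioo 0 ℓ, ‖weakDeriv δ.1 x‖ ^ 2 = 0 := by
      rw [integral_congr_ae (g := fun _ => 0)]
      · simp
      · filter_upwards [hw] with x hx
        simp [hx]
    rw [sobolevNorm, e1, e2]
    simp
  have := hC δ
  rw [hn, mul_zero] at this
  exact norm_le_zero_iff.1 this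

/-- Factorization of the Schrödinger operator through a zero-free solution of `S_q f = 0`. -/
theorem schrodinger_eq_integral_darbouxDeriv {ℓ : ℝ} (hℓ : 0 < ℓ) {q : WNeg12 ℓ} {f : W12 ℓ}
    (hf : IsNonvanishingSolution q f) (y : W12 ℓ) (φ : W12Zero ℓ) :
    schrodinger q y φ = ∫ x in Ioo 0 ℓ, darbouxDeriv f y x *
      (weakDeriv φ.1 x - weakDeriv f x / f.1 x * φ.1.1 x) := by
  have hinv := memW12_inv hℓ f hf.2
  -- With ψ = yφ/f one has fψ = yφ on [0,ℓ], so S_q f = 0 tested with ψ gives (q|yφ) = -∫ f'ψ'. Then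
  -- y'φ' - f'ψ' = (y' - σy)(φ' - σφ) pointwise almost everywhere.
  set ψ : W12Zero ℓ := ⟨⟨fun x => y.1 x * φ.1.1 x * (f.1 x)⁻¹,
    (MemW12.mul (MemW12.mul y.2 φ.1.2) hinv)⟩, by simp [φ.2.1], by simp [φ.2.2]⟩ with hψ
  have h0 := hf.1.2 ψ
  rw [zero_mul, schrodinger] at h0
  have hq : q.toFunctional (mulZero y φ) = q.toFunctional (mulZero f ψ) := by
    refine toFunctional_congr hℓ q fun x hx => ?_
    have := hf.2 x hx
    simp only [mulZero, hψ]
    field_simp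
  have int2 : ∀ u w : W12 ℓ, Integrable (fun x => weakDeriv u x * weakDeriv w x)
      (volume.restrict (Ioo 0 ℓ)) := fun u w =>
    (memLp_weakDeriv u).integrable_mul (memLp_weakDeriv w)
  rw [schrodinger, hq, eq_neg_of_add_eq_zero_right h0, ← sub_eq_add_neg,
    ← integral_sub (int2 _ _) (int2 _ _)]
  refine integral_congr_ae ?_
  filter_upwards [ae_hasDerivAt_weakDeriv hℓ y, ae_hasDerivAt_weakDeriv hℓ f,
    ae_hasDerivAt_weakDeriv hℓ φ.1, ae_hasDerivAt_weakDeriv hℓ ψ.1,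
    ae_restrict_mem measurableSet_Ioo] with x hy hfx hφ hψx hx
  have hne := hf.2 x (Ioo_subset_Icc_self hx)
  have e := hψx.unique ((hy.mul hφ).mul (hfx.inv hne))
  rw [e, darbouxDeriv]
  simp only [Pi.mul_apply]
  field_simp
  ring

/-! ### The transformation kernel -/

/-- The Volterra operator `F ↦ ∫_0^x σ(s) F(s, t - c (x - s)) ds`. -/
noncomputable def volterra (σ : ℝ → ℂ) (c : ℝ) (F : ℝ × ℝ → ℂ) (p : ℝ × ℝ) : ℂ :=
  ∫ s in Ioc 0 p.1, σ s * F (s, p.2 - c * (p.1 - s))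

/-- The propagation direction of the two components of the Dirac system. -/
def direction : Bool → ℝ
  | true => 1
  | false => -1

theorem abs_direction (b : Bool) : |direction b| = 1 := by cases b <;> simp [direction]

open Classical in
/-- The first iterate, supported in `|t| < x`. -/
noncomputable def kernelZero (σ : ℝ → ℂ) : Bool → ℝ × ℝ → ℂ
  | true => fun _ => 0
  | false => fun p => if |p.2| < p.1 then 1 / 2 * σ ((p.1 + p.2) / 2) else 0

/-- The successive approximations of the kernel. -/
noncomputable def kernelIter (σ : ℝ → ℂ) : ℕ → Bool → ℝ × ℝ → ℂ
  | 0 => kernelZero σ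
  | n + 1 => fun b => volterra σ (direction b) (kernelIter σ n (!b))

/-- The two components of the kernel. -/
noncomputable def kernel (σ : ℝ → ℂ) (b : Bool) (p : ℝ × ℝ) : ℂ := ∑' n, kernelIter σ n b p

variable {σ : ℝ → ℂ}

theorem stronglyMeasurable_volterra (hσ : StronglyMeasurable σ) (c : ℝ) {F : ℝ × ℝ → ℂ}
    (hF : StronglyMeasurable F) : StronglyMeasurable (volterra σ c F) := by
  have hS : MeasurableSet {r : (ℝ × ℝ) × ℝ | r.2 ∈ Ioc 0 r.1.1} :=
    (measurableSet_lt measurable_const measurable_snd).inter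
      (measurableSet_le measurable_snd (measurable_fst.comp measurable_fst))
  have h1 : StronglyMeasurable (Function.uncurry fun (p : ℝ × ℝ) (s : ℝ) =>
      {r : (ℝ × ℝ) × ℝ | r.2 ∈ Ioc 0 r.1.1}.indicator
        (fun r => σ r.2 * F (r.2, r.1.2 - c * (r.1.1 - r.2))) (p, s)) := by
    refine StronglyMeasurable.indicator ?_ hS
    exact (hσ.comp_measurable measurable_snd).mul (hF.comp_measurable (by fun_prop))
  convert h1.integral_prod_right (ν := volume) using 1
  funext p
  rw [volterra, ← integral_indicator measurableSet_Ioc]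
  rfl

/-- Finite propagation speed: as |c| = 1, the characteristic through a point with x ≤ |t| satisfies
|t - c(x-s)| ≥ |t| - (x-s) ≥ s, so it stays outside the cone. -/
theorem volterra_eq_zero {c : ℝ} (hc : |c| = 1) {F : ℝ × ℝ → ℂ}
    (hF : ∀ p : ℝ × ℝ, p.1 ≤ |p.2| → F p = 0) (p : ℝ × ℝ) (hp : p.1 ≤ |p.2|) :
    volterra σ c F p = 0 := by
  refine setIntegral_eq_zero_of_forall_eq_zero fun s hs => ?_
  rw [hF, mul_zero]
  have h1 : |p.2| ≤ |p.2 - c * (p.1 - s)| + |c * (p.1 - s)| := by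
    simpa using abs_add_le (p.2 - c * (p.1 - s)) (c * (p.1 - s))
  rw [abs_mul, hc, one_mul, abs_of_nonneg (sub_nonneg.2 hs.2)] at h1
  simp only
  linarith

theorem stronglyMeasurable_kernelZero (hσ : StronglyMeasurable σ) (b : Bool) :
    StronglyMeasurable (kernelZero σ b) := by
  cases b
  · refine StronglyMeasurable.ite (measurableSet_lt (by fun_prop) (by fun_prop)) ?_
      stronglyMeasurable_const
    exact (hσ.comp_measurable (by fun_prop)).const_mul _
  · exact stronglyMeasurable_const

theorem stronglyMeasurable_kernelIter (hσ : StronglyMeasurable σ) (n : ℕ) (b : Bool) :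
    StronglyMeasurable (kernelIter σ n b) := by
  induction n generalizing b with
  | zero => exact stronglyMeasurable_kernelZero hσ b
  | succ n ih => exact stronglyMeasurable_volterra hσ _ (ih _)

theorem kernelIter_eq_zero (n : ℕ) (b : Bool) (p : ℝ × ℝ) (hp : p.1 ≤ |p.2|) :
    kernelIter σ n b p = 0 := by
  induction n generalizing b p with
  | zero => cases b <;> simp [kernelIter, kernelZero, hp]
  | succ n ih => exact volterra_eq_zero (abs_direction b) (ih _) p hp

theorem kernel_eq_zero (b : Bool) (p : ℝ × ℝ) (hp : p.1 ≤ |p.2|) : kernel σ b p = 0 := by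
  simp [kernel, kernelIter_eq_zero _ b p hp]

theorem norm_kernelZero_le (b : Bool) (p : ℝ × ℝ) :
    ‖kernelZero σ b p‖ ≤ 1 / 2 * ‖σ ((p.1 + p.2) / 2)‖ := by
  cases b
  · simp only [kernelZero]
    split_ifs
    · simp
    · simp
  · simp [kernelZero]

/-- The integrand of the recursion for the successive approximations. -/
noncomputable def iterIntegrand (σ : ℝ → ℂ) (n : ℕ) (b : Bool) (p : ℝ × ℝ) (s : ℝ) : ℂ :=
  σ s * kernelIter σ n (!b) (s, p.2 - direction b * (p.1 - s))

theorem stronglyMeasurable_iterIntegrand (hσ : StronglyMeasurable σ) (n : ℕ) (b : Bool)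
    (p : ℝ × ℝ) : StronglyMeasurable (iterIntegrand σ n b p) :=
  hσ.mul ((stronglyMeasurable_kernelIter hσ n _).comp_measurable (by fun_prop))

/-- The zeroth term is unbounded, but along a characteristic σ meets only a translate σ(s+d) of
itself. The product of two L² functions is integrable at every point p, not merely almost every one,
so the first iterate is bounded. -/
theorem iterIntegrand_zero_bound (hσ : StronglyMeasurable σ) (h2 : MemLp σ 2 volume)
    (b : Bool) (p : ℝ × ℝ) :
    IntegrableOn (iterIntegrand σ 0 b p) (Ioc 0 p.1) ∧
      ∫ s in Ioc 0 p.1, ‖iterIntegrand σ 0 b p s‖ ≤ ∫ s, ‖σ s‖ ^ 2 := by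
  have hsq : Integrable (fun s => ‖σ s‖ ^ 2) := (memLp_two_iff_integrable_sq_norm h2.1).1 h2
  set d : ℝ := (p.2 - p.1) / 2
  have hsqd : Integrable (fun s => ‖σ (s + d)‖ ^ 2) := hsq.comp_add_right d
  have hmaj : Integrable (fun s => 1 / 2 * (‖σ s‖ ^ 2 + ‖σ (s + d)‖ ^ 2)) :=
    (hsq.add hsqd).const_mul _
  have hle : ∀ s, ‖iterIntegrand σ 0 b p s‖ ≤ 1 / 2 * (‖σ s‖ ^ 2 + ‖σ (s + d)‖ ^ 2) := by
    intro s
    cases b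
    · simp only [iterIntegrand, kernelIter, Bool.not_false, kernelZero, mul_zero, norm_zero]
      positivity
    · rw [iterIntegrand, norm_mul]
      have h1 := norm_kernelZero_le (σ := σ) (!true) (s, p.2 - direction true * (p.1 - s))
      have e : (s + (p.2 - direction true * (p.1 - s))) / 2 = s + d := by
        simp only [direction, d]; ring
      simp only [e] at h1
      have h3 := mul_le_mul_of_nonneg_left h1 (norm_nonneg (σ s))
      refine h3.trans ?_
      nlinarith [sq_nonneg (‖σ s‖ - ‖σ (s + d)‖), sq_nonneg (‖σ s‖), sq_nonneg ‖σ (s + d)‖]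
  have hI : Integrable (iterIntegrand σ 0 b p) :=
    hmaj.mono' (stronglyMeasurable_iterIntegrand hσ 0 b p).aestronglyMeasurable
      (Filter.Eventually.of_forall hle)
  refine ⟨hI.integrableOn, ?_⟩
  calc _ ≤ ∫ s, ‖iterIntegrand σ 0 b p s‖ :=
        setIntegral_le_integral hI.norm (Filter.Eventually.of_forall fun s => norm_nonneg _)
    _ ≤ ∫ s, 1 / 2 * (‖σ s‖ ^ 2 + ‖σ (s + d)‖ ^ 2) := integral_mono hI.norm hmaj hle
    _ = _ := by
        rw [integral_const_mul, integral_add hsq hsqd,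
          integral_add_right_eq_self (fun s => ‖σ s‖ ^ 2) d]
        ring

/-- The base case supplies M = ∫ |σ|²; each further integration against σ gains the factor θ of
`exists_exp_weight`. -/
theorem exists_iterIntegrand_bound (hσ : StronglyMeasurable σ) (h2 : MemLp σ 2 volume) :
    ∃ M lam θ : ℝ, 0 ≤ M ∧ 0 < lam ∧ 0 ≤ θ ∧ θ < 1 ∧ ∀ n b p,
      IntegrableOn (iterIntegrand σ n b p) (Ioc 0 p.1) ∧
        ∫ s in Ioc 0 p.1, ‖iterIntegrand σ n b p s‖ ≤ M * θ ^ n * Real.exp (lam * p.1) := by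
  obtain ⟨lam, hlam, θ, hθ0, hθ1, hw⟩ := exists_exp_weight (fun s => norm_nonneg (σ s)) h2.norm
  refine ⟨∫ s, ‖σ s‖ ^ 2, lam, θ, integral_nonneg fun s => sq_nonneg _, hlam, hθ0, hθ1,
    fun n => ?_⟩
  set M := ∫ s, ‖σ s‖ ^ 2 with hM
  have hM0 : 0 ≤ M := integral_nonneg fun s => sq_nonneg _
  induction n with
  | zero =>
    intro b p
    obtain ⟨h1, h3⟩ := iterIntegrand_zero_bound hσ h2 b p
    refine ⟨h1, ?_⟩
    -- For p.1 ≤ 0 the weight may be less than 1, but the domain of integration is then empty.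
    rcases le_or_gt p.1 0 with hp | hp
    · rw [Ioc_eq_empty (not_lt.2 hp)]
      simp only [Measure.restrict_empty, integral_zero_measure]
      positivity
    · refine h3.trans ?_
      rw [pow_zero, mul_one]
      exact le_mul_of_one_le_right hM0 (Real.one_le_exp (by positivity))
  | succ n ih =>
    intro b p
    have hle : ∀ s, ‖iterIntegrand σ (n + 1) b p s‖ ≤
        M * θ ^ n * (‖σ s‖ * Real.exp (lam * s)) := by
      intro s
      rw [iterIntegrand, norm_mul]
      -- The induction bound depends on the first coordinate only, which here is s; the shift in the
      -- second coordinate does no harm.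
      have h1 : ‖kernelIter σ (n + 1) (!b) (s, p.2 - direction b * (p.1 - s))‖ ≤
          M * θ ^ n * Real.exp (lam * s) :=
        (norm_integral_le_integral_norm _).trans
          (ih (!b) (s, p.2 - direction b * (p.1 - s))).2
      have := mul_le_mul_of_nonneg_left h1 (norm_nonneg (σ s))
      linarith
    have hmaj : IntegrableOn (fun s => M * θ ^ n * (‖σ s‖ * Real.exp (lam * s))) (Iic p.1) :=
      (hw p.1).1.const_mul _
    have hsub : Ioc 0 p.1 ⊆ Iic p.1 := fun s hs => hs.2
    have hI : IntegrableOn (iterIntegrand σ (n + 1) b p) (Iic p.1) :=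
      Integrable.mono' hmaj (stronglyMeasurable_iterIntegrand hσ _ b p).aestronglyMeasurable
        (Filter.Eventually.of_forall hle)
    refine ⟨hI.mono_set hsub, ?_⟩
    calc _ ≤ ∫ s in Iic p.1, ‖iterIntegrand σ (n + 1) b p s‖ :=
          setIntegral_mono_set hI.norm (Filter.Eventually.of_forall fun s => norm_nonneg _)
            (Filter.Eventually.of_forall hsub)
      _ ≤ ∫ s in Iic p.1, M * θ ^ n * (‖σ s‖ * Real.exp (lam * s)) :=
          setIntegral_mono hI.norm hmaj hle
      _ ≤ M * θ ^ n * (θ * Real.exp (lam * p.1)) := by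
          rw [integral_const_mul]
          exact mul_le_mul_of_nonneg_left (hw p.1).2 (by positivity)
      _ = _ := by ring

/-- Convergence of the successive approximations, with a locally uniform bound. -/
theorem exists_kernel_bound (hσ : StronglyMeasurable σ) (h2 : MemLp σ 2 volume) :
    ∃ C lam : ℝ, 0 ≤ C ∧ 0 < lam ∧ ∀ b p,
      Summable (fun n => kernelIter σ n b p) ∧
      kernel σ b p = kernelZero σ b p + volterra σ (direction b) (kernel σ (!b)) p ∧
      ‖volterra σ (direction b) (kernel σ (!b)) p‖ ≤ C * Real.exp (lam * p.1) := by
  obtain ⟨M, lam, θ, hM, hlam, hθ0, hθ1, h⟩ := exists_iterIntegrand_bound hσ h2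
  have hgeo : ∀ x, HasSum (fun n => M * θ ^ n * Real.exp (lam * x))
      (M * (1 - θ)⁻¹ * Real.exp (lam * x)) := fun x =>
    ((hasSum_geometric_of_lt_one hθ0 hθ1).mul_left M).mul_right _
  have hsucc : ∀ n b p, ‖kernelIter σ (n + 1) b p‖ ≤ M * θ ^ n * Real.exp (lam * p.1) :=
    fun n b p => (norm_integral_le_integral_norm _).trans (h n b p).2
  have hsum1 : ∀ b p, Summable (fun n => kernelIter σ (n + 1) b p) := fun b p =>
    Summable.of_norm_bounded (hgeo p.1).summable fun n => hsucc n b p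
  have hsum : ∀ b p, Summable (fun n => kernelIter σ n b p) := fun b p =>
    (summable_nat_add_iff 1).1 (hsum1 b p)
  have hint : ∀ b (p : ℝ × ℝ), Summable fun n => ∫ s in Ioc 0 p.1, ‖iterIntegrand σ n b p s‖ :=
    fun b p => Summable.of_nonneg_of_le (fun n => integral_nonneg fun s => norm_nonneg _)
      (fun n => (h n b p).2) (hgeo p.1).summable
  have htsum : ∀ b (p : ℝ × ℝ) s, ∑' n, iterIntegrand σ n b p s =
      σ s * kernel σ (!b) (s, p.2 - direction b * (p.1 - s)) := fun b p s => by
    simp only [iterIntegrand, kernel, tsum_mul_left]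
  -- The integrals of the norms are summable, so summation and integration may be exchanged; this
  -- produces the fixed point equation.
  have hV : ∀ b p, HasSum (fun n => kernelIter σ (n + 1) b p)
      (volterra σ (direction b) (kernel σ (!b)) p) := by
    intro b p
    have := hasSum_integral_of_summable_integral_norm (fun n => (h n b p).1) (hint b p)
    simp only [htsum] at this
    exact this
  refine ⟨M * (1 - θ)⁻¹, lam, mul_nonneg hM (inv_nonneg.2 (by linarith)), hlam,
    fun b p => ⟨hsum b p, ?_, ?_⟩⟩
  · rw [kernel, (hsum b p).tsum_eq_zero_add, (hV b p).tsum_eq]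
    rfl
  · rw [← (hV b p).tsum_eq]
    exact tsum_of_norm_bounded (hgeo p.1) fun n => hsucc n b p

theorem stronglyMeasurable_kernel (hσ : StronglyMeasurable σ) (h2 : MemLp σ 2 volume)
    (b : Bool) : StronglyMeasurable (kernel σ b) := by
  obtain ⟨C, lam, -, -, h⟩ := exists_kernel_bound hσ h2
  refine stronglyMeasurable_of_tendsto (u := Filter.atTop)
    (f := fun (n : ℕ) p => ∑ i ∈ Finset.range n, kernelIter σ i b p) (fun n => ?_) ?_
  · exact Finset.stronglyMeasurable_fun_sum _ fun i _ => stronglyMeasurable_kernelIter hσ i b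
  · exact tendsto_pi_nhds.2 fun p => (h b p).1.hasSum.tendsto_sum_nat

/-- A majorant of the kernel in the strip `x ≤ ℓ`. -/
theorem exists_kernel_majorant (hσ : StronglyMeasurable σ) (h2 : MemLp σ 2 volume) (ℓ : ℝ) :
    ∃ C : ℝ, ∀ b x t, x ≤ ℓ → ‖kernel σ b (x, t)‖ ≤
      1 / 2 * ‖σ ((x + t) / 2)‖ + (Icc (-ℓ) ℓ).indicator (fun _ => C) t := by
  obtain ⟨C, lam, hC, hlam, h⟩ := exists_kernel_bound hσ h2
  refine ⟨C * Real.exp (lam * ℓ), fun b x t hx => ?_⟩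
  by_cases ht : t ∈ Icc (-ℓ) ℓ
  · rw [indicator_of_mem ht, (h b (x, t)).2.1]
    refine (norm_add_le _ _).trans (add_le_add (norm_kernelZero_le b (x, t))
      ((h b (x, t)).2.2.trans ?_))
    gcongr
  · rw [indicator_of_notMem ht, kernel_eq_zero]
    · simp
    · simp only
      rw [mem_Icc, ← abs_le, not_le] at ht
      linarith

/-! ### The exponential transform of the kernel -/

theorem integrable_comp_half_add (h1 : Integrable σ) (x : ℝ) :
    Integrable (fun t => σ ((x + t) / 2)) := by
  have := (h1.comp_mul_left' (R := 1 / 2) (by norm_num)).comp_add_left x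
  convert this using 2
  ring_nf

theorem integral_comp_half_add {E : Type*} [NormedAddCommGroup E] [NormedSpace ℝ E]
    (g : ℝ → E) (x : ℝ) : ∫ t, g ((x + t) / 2) = (2 : ℝ) • ∫ t, g t := by
  have e := Measure.integral_comp_mul_left g (1 / 2)
  rw [← integral_add_left_eq_self (fun t => g (1 / 2 * t)) x] at e
  simp only [one_div, inv_inv, Nat.abs_ofNat] at e
  rw [← e]
  congr 1 with t
  congr 1
  ring

/-- Uniform integrability bound for the kernel against exponentials. -/
theorem exists_kernel_exp_bound (hσ : StronglyMeasurable σ) (h1 : Integrable σ)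
    (h2 : MemLp σ 2 volume) (ℓ : ℝ) (ρ : ℂ) :
    ∃ C : ℝ, ∀ b x, x ≤ ℓ →
      Integrable (fun t => kernel σ b (x, t) * Complex.exp (Complex.I * ρ * t)) ∧
      ∫ t, ‖kernel σ b (x, t) * Complex.exp (Complex.I * ρ * t)‖ ≤ C := by
  obtain ⟨C, hC⟩ := exists_kernel_majorant hσ h2 ℓ
  set m : ℝ → ℝ → ℝ := fun x t => (1 / 2 * ‖σ ((x + t) / 2)‖ +
    (Icc (-ℓ) ℓ).indicator (fun _ => C) t) * Real.exp (‖ρ‖ * ℓ) with hm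
  have hI1 : ∀ x, Integrable (fun t => 1 / 2 * ‖σ ((x + t) / 2)‖) := fun x =>
    (integrable_comp_half_add h1 x).norm.const_mul _
  have hI2 : Integrable ((Icc (-ℓ) ℓ).indicator fun _ => C) :=
    (integrable_indicator_iff measurableSet_Icc).2 (integrableOn_const (by simp))
  have hle : ∀ b x t, x ≤ ℓ →
      ‖kernel σ b (x, t) * Complex.exp (Complex.I * ρ * t)‖ ≤ m x t := by
    intro b x t hx
    rw [norm_mul]
    -- The exponential is bounded by e^{|ρ|ℓ} only where |t| < x ≤ ℓ; elsewhere the kernel vanishes.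
    by_cases ht : x ≤ |t|
    · rw [kernel_eq_zero b (x, t) ht, norm_zero, zero_mul]
      exact mul_nonneg ((norm_nonneg _).trans (hC b x t hx)) (Real.exp_pos _).le
    · refine mul_le_mul (hC b x t hx) ?_ (norm_nonneg _) ((norm_nonneg _).trans (hC b x t hx))
      refine (Complex.norm_exp_le_exp_norm _).trans (Real.exp_le_exp.2 ?_)
      rw [norm_mul, norm_mul, Complex.norm_I, one_mul, Complex.norm_real]
      exact mul_le_mul_of_nonneg_left ((not_le.1 ht).le.trans hx) (norm_nonneg _)
  have hmI : ∀ x, Integrable (m x) := fun x => ((hI1 x).add hI2).mul_const _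
  have hKI : ∀ b x, x ≤ ℓ →
      Integrable (fun t => kernel σ b (x, t) * Complex.exp (Complex.I * ρ * t)) := by
    intro b x hx
    refine (hmI x).mono' ?_ (Filter.Eventually.of_forall fun t => hle b x t hx)
    exact (((stronglyMeasurable_kernel hσ h2 b).comp_measurable
      (by fun_prop : Measurable fun t : ℝ => (x, t))).mul
      (by fun_prop : Continuous fun t : ℝ =>
        Complex.exp (Complex.I * ρ * t)).stronglyMeasurable).aestronglyMeasurable
  -- The integral of m x does not depend on x, by translation, so its value at x = 0 serves for
  -- every x ≤ ℓ.
  refine ⟨∫ t, m 0 t, fun b x hx => ⟨hKI b x hx, ?_⟩⟩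
  refine (integral_mono (hKI b x hx).norm (hmI x) fun t => hle b x t hx).trans_eq ?_
  simp only [hm]
  rw [integral_mul_const, integral_mul_const, integral_add (hI1 x) hI2, integral_add (hI1 0) hI2,
    integral_const_mul, integral_const_mul, integral_comp_half_add (fun s => ‖σ s‖),
    integral_comp_half_add (fun s => ‖σ s‖)]

/-- Fubini: for fixed s the shift by c(x-s) disappears under ∫ dt by translation invariance, and C ∫
|h| bounds the double integral. -/
theorem integral_volterra_swap {h : ℝ → ℂ} {G : ℝ × ℝ → ℂ} (hG : StronglyMeasurable G) {x C : ℝ}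
    (hh : IntegrableOn h (Ioc 0 x)) (hC : ∀ s ∈ Ioc 0 x, Integrable (fun t => G (s, t)) ∧
      ∫ t, ‖G (s, t)‖ ≤ C) (c : ℝ) :
    IntegrableOn (fun s => h s * ∫ t, G (s, t)) (Ioc 0 x) ∧
    Integrable (fun t => ∫ s in Ioc 0 x, h s * G (s, t - c * (x - s))) ∧
    ∫ t, ∫ s in Ioc 0 x, h s * G (s, t - c * (x - s)) =
      ∫ s in Ioc 0 x, h s * ∫ t, G (s, t) := by
  set P : ℝ × ℝ → ℂ := fun r => h r.2 * G (r.2, r.1 - c * (x - r.2)) with hP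
  have hPm : AEStronglyMeasurable P (volume.prod (volume.restrict (Ioc 0 x))) :=
    (hh.1.comp_snd).mul (hG.comp_measurable (by fun_prop)).aestronglyMeasurable
  have hnorm : ∀ s, ∫ t, ‖P (t, s)‖ = ‖h s‖ * ∫ t, ‖G (s, t)‖ := fun s => by
    simp only [hP, norm_mul]
    rw [integral_const_mul, integral_sub_right_eq_self (fun t => ‖G (s, t)‖)]
  have hval : ∀ s, ∫ t, P (t, s) = h s * ∫ t, G (s, t) := fun s => by
    simp only [hP]
    rw [integral_const_mul, integral_sub_right_eq_self (fun t => G (s, t))]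
  have hI : Integrable P (volume.prod (volume.restrict (Ioc 0 x))) := by
    refine (integrable_prod_iff' hPm).2 ⟨?_, ?_⟩
    · filter_upwards [ae_restrict_mem measurableSet_Ioc] with s hs
      exact ((hC s hs).1.comp_sub_right (c * (x - s))).const_mul (h s)
    · simp only [hnorm]
      refine Integrable.mono' (hh.norm.mul_const C) (hh.1.norm.mul ?_) ?_
      · exact (hG.norm.integral_prod_right (f := fun s t => ‖G (s, t)‖)).aestronglyMeasurable
      · filter_upwards [ae_restrict_mem measurableSet_Ioc] with s hs
        rw [Real.norm_of_nonneg (mul_nonneg (norm_nonneg _)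
          (integral_nonneg fun t => norm_nonneg _))]
        exact mul_le_mul_of_nonneg_left (hC s hs).2 (norm_nonneg _)
  refine ⟨?_, hI.integral_prod_left, ?_⟩
  · have := hI.integral_prod_right
    simp only [hval] at this
    exact this
  · have := integral_integral_swap (f := fun t s => P (t, s)) hI
    simp only [hval] at this
    exact this

/-- The exponential transform of the kernel. -/
noncomputable def kernelTransform (σ : ℝ → ℂ) (ρ : ℂ) (b : Bool) (x : ℝ) : ℂ :=
  ∫ t, kernel σ b (x, t) * Complex.exp (Complex.I * ρ * t)

theorem kernelTransform_eq_intervalIntegral (ρ : ℂ) (b : Bool) {x : ℝ} (hx : 0 ≤ x) :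
    kernelTransform σ ρ b x =
      ∫ t in (-x)..x, kernel σ b (x, t) * Complex.exp (Complex.I * ρ * t) := by
  rw [kernelTransform, intervalIntegral.integral_of_le (by linarith),
    setIntegral_eq_integral_of_forall_compl_eq_zero]
  intro t ht
  rw [kernel_eq_zero, zero_mul]
  by_contra hlt
  have := abs_lt.1 (not_le.1 hlt)
  exact ht ⟨this.1, this.2.le⟩

/-- The substitution t = 2s - x explains the form of `kernelZero`: its transform is the Duhamel term
by which e^{iρx} drives b. -/
theorem integral_kernelZero_exp (ρ : ℂ) {x : ℝ} (hx : 0 ≤ x) :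
    ∫ t, kernelZero σ false (x, t) * Complex.exp (Complex.I * ρ * t) =
      ∫ s in (0 : ℝ)..x, σ s * Complex.exp (Complex.I * ρ * (2 * s - x)) := by
  have e1 := intervalIntegral.integral_comp_mul_add (a := -x) (b := x) (c := 1 / 2)
    (fun s => σ s * Complex.exp (Complex.I * ρ * (2 * s - x))) (by norm_num) (x / 2)
  rw [show (1 / 2 : ℝ) * -x + x / 2 = 0 by ring, show (1 / 2 : ℝ) * x + x / 2 = x by ring] at e1
  have e2 : (∫ s in (0 : ℝ)..x, σ s * Complex.exp (Complex.I * ρ * (2 * s - x))) =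
      (1 / 2 : ℝ) • (1 / 2 : ℝ)⁻¹ •
        ∫ s in (0 : ℝ)..x, σ s * Complex.exp (Complex.I * ρ * (2 * s - x)) := by
    rw [smul_smul]; norm_num
  rw [e2, ← e1, ← intervalIntegral.integral_smul, intervalIntegral.integral_of_le (by linarith),
    integral_Ioc_eq_integral_Ioo, ← integral_indicator measurableSet_Ioo]
  congr 1 with t
  by_cases ht : t ∈ Ioo (-x) x
  · rw [indicator_of_mem ht]
    simp only [kernelZero, if_pos (abs_lt.2 ht)]
    rw [Complex.real_smul, show (1 / 2 : ℝ) * t + x / 2 = (x + t) / 2 by ring]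
    push_cast
    rw [show (2 * (((x : ℂ) + t) / 2) - x) = t by ring]
    ring
  · rw [indicator_of_notMem ht]
    simp only [kernelZero]
    rw [if_neg (fun h => ht (abs_lt.1 h)), zero_mul]

/-- The transform of the fixed point equation: translation along the characteristic becomes the
phase e^{±iρ(x-s)}, giving Duhamel's formula. -/
theorem kernelTransform_eq (hσ : StronglyMeasurable σ) (h1 : Integrable σ)
    (h2 : MemLp σ 2 volume) (ρ : ℂ) (b : Bool) (x : ℝ) :
    IntegrableOn (fun s => σ s * Complex.exp (Complex.I * ρ * (direction b * (x - s))) *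
      kernelTransform σ ρ (!b) s) (Ioc 0 x) ∧
    kernelTransform σ ρ b x =
      (∫ t, kernelZero σ b (x, t) * Complex.exp (Complex.I * ρ * t)) +
      ∫ s in Ioc 0 x, σ s * Complex.exp (Complex.I * ρ * (direction b * (x - s))) *
        kernelTransform σ ρ (!b) s := by
  obtain ⟨C, hC⟩ := exists_kernel_exp_bound hσ h1 h2 x ρ
  obtain ⟨_, _, -, -, hK⟩ := exists_kernel_bound hσ h2
  have hh : IntegrableOn
      (fun s : ℝ => σ s * Complex.exp (Complex.I * ρ * (direction b * (x - s)))) (Ioc 0 x) := by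
    rw [← integrableOn_Icc_iff_integrableOn_Ioc]
    exact h1.integrableOn.mul_continuousOn (by fun_prop) isCompact_Icc
  have hG : StronglyMeasurable fun p : ℝ × ℝ =>
      kernel σ (!b) p * Complex.exp (Complex.I * ρ * p.2) :=
    (stronglyMeasurable_kernel hσ h2 _).mul (by fun_prop : Continuous fun p : ℝ × ℝ =>
        Complex.exp (Complex.I * ρ * p.2)).stronglyMeasurable
  obtain ⟨i1, i2, i3⟩ := integral_volterra_swap hG hh (fun s hs => hC (!b) s hs.2) (direction b)
  refine ⟨i1, ?_⟩
  have hv : ∀ t : ℝ, ∫ s in Ioc 0 x,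
      σ s * Complex.exp (Complex.I * ρ * (direction b * (x - s))) *
        (kernel σ (!b) (s, t - direction b * (x - s)) *
          Complex.exp (Complex.I * ρ * (t - direction b * (x - s) : ℝ))) =
      volterra σ (direction b) (kernel σ (!b)) (x, t) * Complex.exp (Complex.I * ρ * t) := by
    intro t
    rw [volterra, ← integral_mul_const]
    congr 1 with s
    have : Complex.exp (Complex.I * ρ * t) =
        Complex.exp (Complex.I * ρ * (direction b * (x - s))) *
          Complex.exp (Complex.I * ρ * (t - direction b * (x - s) : ℝ)) := by
      rw [← Complex.exp_add]; congr 1; push_cast; ring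
    rw [this]
    ring
  simp only [hv] at i2 i3
  have hT : Integrable fun t => kernel σ b (x, t) * Complex.exp (Complex.I * ρ * t) :=
    (hC b x le_rfl).1
  -- The zeroth term is the kernel minus its Volterra part, both already integrable.
  have hZ : Integrable fun t => kernelZero σ b (x, t) * Complex.exp (Complex.I * ρ * t) := by
    have := hT.sub i2
    refine this.congr (Filter.Eventually.of_forall fun t => ?_)
    simp only [Pi.sub_apply]
    rw [(hK b (x, t)).2.1]
    ring
  rw [kernelTransform]
  unfold kernelTransform
  rw [← i3, ← integral_add hZ i2]
  congr 1 with t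
  rw [(hK b (x, t)).2.1]
  ring

/-! ### The Dirac system -/

theorem exp_mul_eq_one_add_integral (μ : ℂ) (x : ℝ) :
    Complex.exp (μ * x) = 1 + ∫ t in (0 : ℝ)..x, μ * Complex.exp (μ * t) := by
  have hd : ∀ t ∈ uIcc 0 x, HasDerivAt (fun t : ℝ => Complex.exp (μ * t))
      (μ * Complex.exp (μ * t)) t := by
    intro t _
    have h1 : HasDerivAt (fun t : ℝ => μ * (t : ℂ)) μ t := by
      simpa using (Complex.ofRealCLM.hasDerivAt (x := t)).const_mul μ
    simpa [mul_comm] using h1.cexp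
  rw [intervalIntegral.integral_eq_sub_of_hasDerivAt hd
    ((by fun_prop : Continuous fun t : ℝ => μ * Complex.exp (μ * t)).intervalIntegrable _ _)]
  simp

/-- Variation of constants. -/
theorem eq_primitive_of_eq_exp_mul {ℓ : ℝ} (hℓ : 0 ≤ ℓ) {a p : ℝ → ℂ} {μ c : ℂ}
    (hp : IntervalIntegrable (fun s => Complex.exp (-μ * s) * p s) volume 0 ℓ)
    (ha : ∀ x ∈ Icc 0 ℓ, a x =
      Complex.exp (μ * x) * (c + ∫ s in (0 : ℝ)..x, Complex.exp (-μ * s) * p s)) :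
    ContinuousOn a (Icc 0 ℓ) ∧
      ∀ x ∈ Icc 0 ℓ, a x = c + ∫ s in (0 : ℝ)..x, (μ * a s + p s) := by
  have hP := (absolutelyContinuous_primitive hp c).continuousOn
  rw [uIcc_of_le hℓ] at hP
  refine ⟨ContinuousOn.congr (ContinuousOn.mul (by fun_prop) hP) ha, fun x hx => ?_⟩
  have hE : IntervalIntegrable (fun t : ℝ => μ * Complex.exp (μ * t)) volume 0 ℓ :=
    (by fun_prop : Continuous fun t : ℝ => μ * Complex.exp (μ * t)).intervalIntegrable _ _
  have key := primitive_mul hE hp 1 c (x := x) (by rwa [uIcc_of_le hℓ])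
  simp only [← exp_mul_eq_one_add_integral] at key
  rw [ha x hx, key, one_mul]
  congr 1
  refine intervalIntegral.integral_congr fun t ht => ?_
  rw [uIcc_of_le hx.1] at ht
  rw [ha t ⟨ht.1, ht.2.trans hx.2⟩, ← mul_assoc (Complex.exp (μ * t)) (Complex.exp (-μ * t)),
    ← Complex.exp_add]
  simp
  ring

/-- The solution of the Dirac system, written with the transform of the kernel. -/
theorem dirac_kernelTransform {σ : ℝ → ℂ} (hσ : StronglyMeasurable σ) (h1 : Integrable σ)
    (h2 : MemLp σ 2 volume) {ℓ : ℝ} (hℓ : 0 ≤ ℓ) (ρ : ℂ) {a b : ℝ → ℂ}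
    (ha : ∀ x : ℝ, a x = Complex.exp (Complex.I * ρ * x) + kernelTransform σ ρ true x)
    (hb : ∀ x, b x = kernelTransform σ ρ false x) :
    (ContinuousOn a (Icc 0 ℓ) ∧
      ∀ x ∈ Icc 0 ℓ, a x = 1 + ∫ s in (0 : ℝ)..x, (Complex.I * ρ * a s + σ s * b s)) ∧
    ContinuousOn b (Icc 0 ℓ) ∧
      ∀ x ∈ Icc 0 ℓ, b x = 0 + ∫ s in (0 : ℝ)..x, (-(Complex.I * ρ) * b s + σ s * a s) := by
  have hexp : ∀ (μ : ℂ) (x : ℝ), Complex.exp (μ * x) * Complex.exp (-μ * x) = 1 := fun μ x => by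
    rw [← Complex.exp_add]; simp
  have hT : ∀ d x s, σ s * Complex.exp (Complex.I * ρ * (direction d * (x - s))) *
      kernelTransform σ ρ (!d) s = Complex.exp (Complex.I * ρ * direction d * x) *
        (Complex.exp (-(Complex.I * ρ * direction d) * s) *
          (σ s * kernelTransform σ ρ (!d) s)) := by
    intro d x s
    rw [show Complex.I * ρ * (direction d * ((x : ℂ) - s)) =
      Complex.I * ρ * direction d * x + -(Complex.I * ρ * direction d) * s by ring,
      Complex.exp_add]
    ring
  have hI : ∀ d, IntervalIntegrable (fun s : ℝ => Complex.exp (-(Complex.I * ρ * direction d) * s) *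
      (σ s * kernelTransform σ ρ (!d) s)) volume 0 ℓ := by
    intro d
    rw [intervalIntegrable_iff_integrableOn_Ioc_of_le hℓ]
    -- The Duhamel integrand at x = ℓ is integrable; multiplying by a constant removes its phase in
    -- ℓ.
    have := ((kernelTransform_eq hσ h1 h2 ρ d ℓ).1).const_mul
      (Complex.exp (-(Complex.I * ρ * direction d) * ℓ))
    refine this.congr (Filter.Eventually.of_forall fun s => ?_)
    beta_reduce
    rw [hT, ← mul_assoc, mul_comm (Complex.exp _) (Complex.exp _), hexp, one_mul]
  have hV : ∀ d x, 0 ≤ x → kernelTransform σ ρ d x =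
      (∫ t, kernelZero σ d (x, t) * Complex.exp (Complex.I * ρ * t)) +
      Complex.exp (Complex.I * ρ * direction d * x) * ∫ s in (0 : ℝ)..x,
        Complex.exp (-(Complex.I * ρ * direction d) * s) *
          (σ s * kernelTransform σ ρ (!d) s) := by
    intro d x hx
    rw [(kernelTransform_eq hσ h1 h2 ρ d x).2]
    simp only [hT]
    rw [integral_const_mul, intervalIntegral.integral_of_le hx]
  have hdt : ((direction true : ℝ) : ℂ) = 1 := by simp [direction]
  have hdf : ((direction false : ℝ) : ℂ) = -1 := by simp [direction]
  have hIt := hI true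
  have hIf := hI false
  simp only [hdt, hdf, Bool.not_true, Bool.not_false, mul_one, ← hb] at hIt hIf
  refine ⟨eq_primitive_of_eq_exp_mul hℓ hIt fun x hx => ?_,
    eq_primitive_of_eq_exp_mul hℓ (p := fun s => σ s * a s) ?_ fun x hx => ?_⟩
  · rw [ha, hV true x hx.1]
    simp only [hdt, Bool.not_true, mul_one, ← hb, kernelZero, zero_mul, integral_zero, zero_add]
    ring
  -- The part e^{iρs} of a, times the integrating factor e^{iρs} of the equation for b, gives
  -- e^{2iρs}.
  · have hE : IntervalIntegrable (fun s : ℝ => σ s * Complex.exp (Complex.I * ρ * (2 * s)))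
        volume 0 ℓ := h1.intervalIntegrable.mul_continuousOn (by fun_prop)
    refine (hE.add hIf).congr (fun s _ => ?_)
    rw [ha, show Complex.I * ρ * (2 * (s : ℂ)) =
      -(-(Complex.I * ρ)) * s + Complex.I * ρ * s by ring, Complex.exp_add]
    rw [mul_neg_one]
    ring
  · have hE : IntervalIntegrable (fun s : ℝ => σ s * Complex.exp (Complex.I * ρ * (2 * s)))
        volume 0 x := h1.intervalIntegrable.mul_continuousOn (by fun_prop)
    rw [hb, hV false x hx.1, integral_kernelZero_exp ρ hx.1]
    simp only [hdf, Bool.not_false, mul_neg_one]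
    have hIx := hIf.mono_set (uIcc_subset_of_mem hx)
    simp only [mul_neg_one] at hIx
    have e1 : ∀ s : ℝ, σ s * Complex.exp (Complex.I * ρ * (2 * s - x)) =
        Complex.exp (-(Complex.I * ρ) * x) * (σ s * Complex.exp (Complex.I * ρ * (2 * s))) := by
      intro s
      rw [show Complex.I * ρ * (2 * (s : ℂ) - x) =
        -(Complex.I * ρ) * x + Complex.I * ρ * (2 * s) by ring, Complex.exp_add]
      ring
    simp only [e1]
    rw [intervalIntegral.integral_const_mul, ← mul_add, ← intervalIntegral.integral_add hE hIx,
      zero_add]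
    congr 1
    refine intervalIntegral.integral_congr fun s _ => ?_
    rw [ha, show Complex.I * ρ * (2 * (s : ℂ)) =
      -(-(Complex.I * ρ)) * s + Complex.I * ρ * s by ring, Complex.exp_add]
    ring

/-- The sum and difference y = a + b, z = a - b undo the diagonalization of the iρ part, and σ,
which couples a and b, becomes diagonal. -/
theorem exists_dirac_solution {σ : ℝ → ℂ} (hσ : StronglyMeasurable σ) (h1 : Integrable σ)
    (h2 : MemLp σ 2 volume) {ℓ : ℝ} (hℓ : 0 ≤ ℓ) (ρ : ℂ) :
    ∃ y z : ℝ → ℂ, ContinuousOn y (Icc 0 ℓ) ∧ ContinuousOn z (Icc 0 ℓ) ∧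
      (∀ x ∈ Icc 0 ℓ, y x = 1 + ∫ s in (0 : ℝ)..x, (σ s * y s + Complex.I * ρ * z s)) ∧
      (∀ x ∈ Icc 0 ℓ, z x = 1 + ∫ s in (0 : ℝ)..x, (Complex.I * ρ * y s - σ s * z s)) ∧
      ∀ x, y x = Complex.exp (Complex.I * ρ * x) +
        (kernelTransform σ ρ true x + kernelTransform σ ρ false x) := by
  set a : ℝ → ℂ := fun x => Complex.exp (Complex.I * ρ * x) + kernelTransform σ ρ true x with ha
  set b : ℝ → ℂ := fun x => kernelTransform σ ρ false x with hb
  obtain ⟨⟨hac, hae⟩, hbc, hbe⟩ := dirac_kernelTransform hσ h1 h2 hℓ ρ (a := a) (b := b)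
    (fun _ => rfl) (fun _ => rfl)
  have int1 : ∀ {u w : ℝ → ℂ} (c : ℂ), ContinuousOn u (Icc 0 ℓ) → ContinuousOn w (Icc 0 ℓ) →
      ∀ x ∈ Icc 0 ℓ, IntervalIntegrable (fun s => c * u s + σ s * w s) volume 0 x := by
    intro u w c hu hw x hx
    have hs : uIcc 0 x ⊆ Icc 0 ℓ := by
      rw [uIcc_of_le hx.1]; exact Icc_subset_Icc_right hx.2
    exact ((hu.mono hs).intervalIntegrable.const_mul c).add
      (h1.intervalIntegrable.mul_continuousOn (hw.mono hs))
  refine ⟨fun x => a x + b x, fun x => a x - b x, hac.add hbc, hac.sub hbc, fun x hx => ?_,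
    fun x hx => ?_, fun x => ?_⟩
  · simp only
    rw [hae x hx, hbe x hx, zero_add, add_assoc,
      ← intervalIntegral.integral_add (int1 _ hac hbc x hx) (int1 _ hbc hac x hx)]
    congr 2 with s
    ring
  · simp only
    rw [hae x hx, hbe x hx, zero_add, add_sub_assoc,
      ← intervalIntegral.integral_sub (int1 _ hac hbc x hx) (int1 _ hbc hac x hx)]
    congr 2 with s
    ring
  · simp only [ha, hb, add_assoc]

/-! ### Square integrability of the kernel -/

/-- The majorant is square integrable on the whole strip [0,ℓ] × ℝ, since ∫ |σ((x+t)/2)|² dt = 2 ∫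
|σ|² for every x. -/
theorem memLp_kernel_triangle {σ : ℝ → ℂ} (hσ : StronglyMeasurable σ) (h2 : MemLp σ 2 volume)
    (ℓ : ℝ) (b : Bool) : MemLp (kernel σ b) 2 (volume.restrict (triangle ℓ)) := by
  obtain ⟨C, hC⟩ := exists_kernel_majorant hσ h2 ℓ
  set ν : Measure (ℝ × ℝ) := (volume.restrict (Icc 0 ℓ)).prod volume with hν
  have hνe : ν = volume.restrict (Icc 0 ℓ ×ˢ univ) := by
    rw [Measure.volume_eq_prod, ← Measure.prod_restrict, Measure.restrict_univ]
  have hsub : triangle ℓ ⊆ Icc 0 ℓ ×ˢ univ := fun p hp => ⟨⟨hp.1, hp.2.1⟩, trivial⟩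
  have hsq : Integrable (fun s => ‖σ s‖ ^ 2) := (memLp_two_iff_integrable_sq_norm h2.1).1 h2
  have hS : MemLp (fun p : ℝ × ℝ => σ ((p.1 + p.2) / 2)) 2 ν := by
    have hm : StronglyMeasurable fun p : ℝ × ℝ => σ ((p.1 + p.2) / 2) :=
      hσ.comp_measurable (by fun_prop)
    have hm2 : AEStronglyMeasurable (fun p : ℝ × ℝ => ‖σ ((p.1 + p.2) / 2)‖ ^ 2) ν :=
      (hm.norm.pow 2).aestronglyMeasurable
    rw [memLp_two_iff_integrable_sq_norm hm.aestronglyMeasurable, hν, integrable_prod_iff hm2]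
    constructor
    · refine Filter.Eventually.of_forall fun x => ?_
      have := (hsq.comp_mul_left' (R := 1 / 2) (by norm_num)).comp_add_left x
      refine this.congr (Filter.Eventually.of_forall fun t => ?_)
      beta_reduce
      rw [show 1 / 2 * (x + t) = (x + t) / 2 by ring]
    · simp only [norm_pow, norm_norm]
      simp only [integral_comp_half_add fun s => ‖σ s‖ ^ 2]
      exact integrable_const _
  have hconst : MemLp (fun p : ℝ × ℝ => (Icc (-ℓ) ℓ).indicator (fun _ => C) p.2) 2 ν := by
    have hms : MeasurableSet {p : ℝ × ℝ | p.2 ∈ Icc (-ℓ) ℓ} := measurable_snd measurableSet_Icc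
    have : (fun p : ℝ × ℝ => (Icc (-ℓ) ℓ).indicator (fun _ => C) p.2) =
        (univ ×ˢ Icc (-ℓ) ℓ : Set (ℝ × ℝ)).indicator fun _ => C := by
      funext p
      by_cases hp : p.2 ∈ Icc (-ℓ) ℓ
      · rw [indicator_of_mem hp, indicator_of_mem (mem_prod.2 ⟨mem_univ p.1, hp⟩)]
      · rw [indicator_of_notMem hp, indicator_of_notMem fun h => hp h.2]
    rw [this]
    refine memLp_indicator_const 2 (MeasurableSet.univ.prod measurableSet_Icc) C (Or.inr ?_)
    rw [hν, Measure.prod_prod]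
    simp [ENNReal.mul_eq_top]
  have hmaj : MemLp (fun p : ℝ × ℝ => 1 / 2 * ‖σ ((p.1 + p.2) / 2)‖ +
      (Icc (-ℓ) ℓ).indicator (fun _ => C) p.2) 2 ν := (hS.norm.const_mul _).add hconst
  have hle : volume.restrict (triangle ℓ) ≤ ν := by
    rw [hνe]; exact Measure.restrict_mono hsub le_rfl
  have hK : MemLp (kernel σ b) 2 ν := by
    refine hmaj.mono' (stronglyMeasurable_kernel hσ h2 b).aestronglyMeasurable ?_
    rw [hνe]
    filter_upwards [ae_restrict_mem (measurableSet_Icc.prod MeasurableSet.univ)] with p hp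
    exact hC b p.1 p.2 hp.1.2
  exact hK.mono_measure hle

/-! ### Solutions of the Schrödinger equation and of the Dirac system -/

/-- The iteration evaluates σ pointwise and on all of ℝ, so it needs a strongly measurable
representative of f'/f, extended by zero. -/
theorem exists_measurable_logDeriv {ℓ : ℝ} (f : W12 ℓ) (hf : ∀ x ∈ Icc 0 ℓ, f.1 x ≠ 0) :
    ∃ σ : ℝ → ℂ, StronglyMeasurable σ ∧ Integrable σ ∧ MemLp σ 2 volume ∧
      σ =ᵐ[volume.restrict (Ioo 0 ℓ)] fun x => weakDeriv f x / f.1 x := by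
  have hL : MemLp (fun x => weakDeriv f x / f.1 x) 2 (volume.restrict (Ioo 0 ℓ)) := by
    have := memLp_continuousOn_mul (f.2.1.inv₀ hf) (memLp_weakDeriv f)
    simp only [div_eq_inv_mul]
    exact this
  have hm := hL.1.stronglyMeasurable_mk
  have he := hL.1.ae_eq_mk
  have hL' := (memLp_congr_ae he).1 hL
  refine ⟨(Ioo 0 ℓ).indicator (hL.1.mk _), hm.indicator measurableSet_Ioo,
    (integrable_indicator_iff measurableSet_Ioo).2 (hL'.integrable (by norm_num)),
    (memLp_indicator_iff_restrict measurableSet_Ioo).2 hL', ?_⟩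
  filter_upwards [he, ae_restrict_mem measurableSet_Ioo] with x hx hxm
  rw [indicator_of_mem hxm, hx]

theorem intervalIntegral_congr_of_ae_restrict {ℓ : ℝ} {u v : ℝ → ℂ}
    (h : u =ᵐ[volume.restrict (Ioo 0 ℓ)] v) {x : ℝ} (hx : x ∈ Icc 0 ℓ) :
    ∫ t in (0 : ℝ)..x, u t = ∫ t in (0 : ℝ)..x, v t := by
  rw [intervalIntegral.integral_of_le hx.1, intervalIntegral.integral_of_le hx.1,
    integral_Ioc_eq_integral_Ioo, integral_Ioc_eq_integral_Ioo]
  exact integral_congr_ae (ae_restrict_of_ae_restrict_of_subset (Ioo_subset_Ioo_right hx.2) h)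

/-- Integration by parts; the boundary terms vanish because φ does at both ends. -/
theorem integral_mul_weakDeriv {ℓ : ℝ} (hℓ : 0 < ℓ) {u v : ℝ → ℂ} {c : ℂ}
    (hv : IntervalIntegrable v volume 0 ℓ)
    (hu : ∀ x ∈ Icc 0 ℓ, u x = c + ∫ t in (0 : ℝ)..x, v t) (φ : W12Zero ℓ) :
    ∫ x in Ioo 0 ℓ, u x * weakDeriv φ.1 x = -∫ x in Ioo 0 ℓ, v x * φ.1.1 x := by
  have hφI := memLp_two_intervalIntegrable hℓ.le (memLp_weakDeriv φ.1)
  have key := primitive_mul hv hφI c 0 (x := ℓ) (by simp)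
  have hφe : ∀ x ∈ Icc 0 ℓ, φ.1.1 x = 0 + ∫ t in (0 : ℝ)..x, weakDeriv φ.1 t := by
    intro x hx
    rw [eq_integral_weakDeriv hℓ φ.1 x hx, φ.2.1]
  have huc : ContinuousOn u (Icc 0 ℓ) := by
    have := (absolutelyContinuous_primitive hv c).continuousOn
    rw [uIcc_of_le hℓ.le] at this
    exact this.congr hu
  rw [← hφe ℓ (right_mem_Icc.2 hℓ.le), φ.2.2, mul_zero, mul_zero, zero_add,
    intervalIntegral.integral_congr (g := fun t => v t * φ.1.1 t + u t * weakDeriv φ.1 t)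
      (fun t ht => by
        rw [uIcc_of_le hℓ.le] at ht
        simp only
        rw [← hφe t ht, ← hu t ht]),
    intervalIntegral.integral_add
      (hv.mul_continuousOn (by rw [uIcc_of_le hℓ.le]; exact φ.1.2.1))
      (hφI.continuousOn_mul (by rwa [uIcc_of_le hℓ.le])),
    intervalIntegral.integral_of_le hℓ.le, intervalIntegral.integral_of_le hℓ.le,
    integral_Ioc_eq_integral_Ioo, integral_Ioc_eq_integral_Ioo] at key
  linear_combination -key

/-- A solution of the Dirac system gives an exponential solution. -/
theorem isExponentialSolution_of_dirac {ℓ : ℝ} (hℓ : 0 < ℓ) {q : WNeg12 ℓ} {f : W12 ℓ}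
    (hf : IsNonvanishingSolution q f) {σ : ℝ → ℂ}
    (h2 : MemLp σ 2 (volume.restrict (Ioo 0 ℓ)))
    (hσf : σ =ᵐ[volume.restrict (Ioo 0 ℓ)] fun x => weakDeriv f x / f.1 x) {ρ : ℂ}
    {y z : ℝ → ℂ} (hyc : ContinuousOn y (Icc 0 ℓ)) (hzc : ContinuousOn z (Icc 0 ℓ))
    (hy : ∀ x ∈ Icc 0 ℓ, y x = 1 + ∫ s in (0 : ℝ)..x, (σ s * y s + Complex.I * ρ * z s))
    (hz : ∀ x ∈ Icc 0 ℓ, z x = 1 + ∫ s in (0 : ℝ)..x, (Complex.I * ρ * y s - σ s * z s)) :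
    ∃ Y : W12 ℓ, Y.1 = y ∧ IsExponentialSolution q f ρ Y := by
  have mulσ : ∀ {u : ℝ → ℂ}, ContinuousOn u (Icc 0 ℓ) →
      MemLp (fun s => σ s * u s) 2 (volume.restrict (Ioo 0 ℓ)) := fun hu => by
    simpa only [mul_comm] using memLp_continuousOn_mul hu h2
  have hvy : MemLp (fun s => σ s * y s + Complex.I * ρ * z s) 2 (volume.restrict (Ioo 0 ℓ)) :=
    (mulσ hyc).add ((memLp_continuousOn hzc).const_mul _)
  have hvz : MemLp (fun s => Complex.I * ρ * y s - σ s * z s) 2 (volume.restrict (Ioo 0 ℓ)) :=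
    ((memLp_continuousOn hyc).const_mul _).sub (mulσ hzc)
  set Y : W12 ℓ := ⟨y, memW12_of_primitive hℓ.le hvy hy⟩ with hY
  -- Since iρz represents D_f y, no division by ρ occurs and ρ = 0 needs no separate treatment.
  have hD : darbouxDeriv f Y =ᵐ[volume.restrict (Ioo 0 ℓ)] fun x => Complex.I * ρ * z x := by
    filter_upwards [weakDeriv_ae_eq_of_primitive hℓ Y
      (memLp_two_intervalIntegrable hℓ.le hvy) hy, hσf] with x h3 h4
    rw [darbouxDeriv, h3, ← h4]
    simp only [hY]
    ring
  have hsol : ∀ φ : W12Zero ℓ,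
      schrodinger q Y φ = ρ ^ 2 * ∫ x in Ioo 0 ℓ, Y.1 x * φ.1.1 x := by
    intro φ
    have hparts := integral_mul_weakDeriv hℓ (memLp_two_intervalIntegrable hℓ.le hvz) hz φ
    have hφL := memLp_continuousOn φ.1.2.1
    have i1 : Integrable (fun x => z x * weakDeriv φ.1 x) (volume.restrict (Ioo 0 ℓ)) :=
      (memLp_continuousOn hzc).integrable_mul (memLp_weakDeriv φ.1)
    have i2 : Integrable (fun x => σ x * z x * φ.1.1 x) (volume.restrict (Ioo 0 ℓ)) :=
      (mulσ hzc).integrable_mul hφL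
    have i3 : Integrable (fun x => Complex.I * ρ * (y x * φ.1.1 x))
        (volume.restrict (Ioo 0 ℓ)) :=
      ((memLp_continuousOn hyc).integrable_mul hφL).const_mul _
    have e1 : ∫ x in Ioo 0 ℓ, (Complex.I * ρ * y x - σ x * z x) * φ.1.1 x =
        Complex.I * ρ * (∫ x in Ioo 0 ℓ, y x * φ.1.1 x) -
          ∫ x in Ioo 0 ℓ, σ x * z x * φ.1.1 x := by
      rw [← integral_const_mul, ← integral_sub i3 i2]
      congr 1 with x
      ring
    have e2 : schrodinger q Y φ = Complex.I * ρ *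
        ((∫ x in Ioo 0 ℓ, z x * weakDeriv φ.1 x) - ∫ x in Ioo 0 ℓ, σ x * z x * φ.1.1 x) := by
      rw [schrodinger_eq_integral_darbouxDeriv hℓ hf, ← integral_sub i1 i2, ← integral_const_mul]
      refine integral_congr_ae ?_
      filter_upwards [hD, hσf] with x h3 h4
      rw [h3, ← h4]
      ring
    rw [e2, hparts, e1]
    linear_combination (-ρ ^ 2 * ∫ x in Ioo 0 ℓ, y x * φ.1.1 x) * Complex.I_sq
  have y0 : y 0 = 1 := by simpa using hy 0 (left_mem_Icc.2 hℓ.le)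
  have z0 : z 0 = 1 := by simpa using hz 0 (left_mem_Icc.2 hℓ.le)
  refine ⟨Y, rfl, ⟨⟨fun x => ρ ^ 2 * y x, (memLp_continuousOn hyc).const_mul _, fun φ _ => ?_⟩,
    hsol⟩, y0, fun x => Complex.I * ρ * z x, continuousOn_const.mul hzc, hD.symm, ?_⟩
  · rw [hsol φ, ← integral_const_mul]
    simp only [hY, mul_assoc]
  · simp [z0]

theorem IsTestFunction.memW12 {ℓ : ℝ} (hℓ : 0 ≤ ℓ) {φ : ℝ → ℂ} (hφ : IsTestFunction ℓ φ) :
    MemW12 ℓ φ := by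
  have hd : ContDiff ℝ 1 φ := hφ.1.of_le (by exact_mod_cast le_top)
  exact memW12_of_primitive hℓ (c := 0)
    (memLp_continuousOn (hd.continuous_deriv (by norm_num)).continuousOn)
    fun x _ => hφ.eq_primitive x

/-- An exponential solution satisfies a first order system in integral form. -/
theorem IsExponentialSolution.exists_system {ℓ : ℝ} (hℓ : 0 < ℓ) {q : WNeg12 ℓ} {f : W12 ℓ}
    (hf : IsNonvanishingSolution q f) {σ : ℝ → ℂ}
    (h2 : MemLp σ 2 (volume.restrict (Ioo 0 ℓ)))
    (hσf : σ =ᵐ[volume.restrict (Ioo 0 ℓ)] fun x => weakDeriv f x / f.1 x) {ρ : ℂ}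
    {y : W12 ℓ} (hy : IsExponentialSolution q f ρ y) :
    ∃ w : ℝ → ℂ, ContinuousOn w (Icc 0 ℓ) ∧
      (∀ x ∈ Icc 0 ℓ, y.1 x = 1 + ∫ s in (0 : ℝ)..x, (σ s * y.1 s + w s)) ∧
      ∀ x ∈ Icc 0 ℓ, w x = Complex.I * ρ + ∫ s in (0 : ℝ)..x, (-(σ s * w s) - ρ ^ 2 * y.1 s) := by
  obtain ⟨⟨-, hsol⟩, hy0, w, hwc, hwD, hw0⟩ := hy
  -- The second unknown is w = D_f y itself rather than w/(iρ), so that ρ = 0 is included.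
  refine ⟨w, hwc, fun x hx => ?_, ?_⟩
  · rw [eq_integral_weakDeriv hℓ y x hx, hy0]
    congr 1
    refine intervalIntegral_congr_of_ae_restrict ?_ hx
    filter_upwards [hwD, hσf] with x h3 h4
    rw [h3, h4, darbouxDeriv]
    ring
  · have hσw : MemLp (fun s => σ s * w s) 2 (volume.restrict (Ioo 0 ℓ)) := by
      simpa only [mul_comm] using memLp_continuousOn_mul hwc h2
    have hyL := memLp_continuousOn y.2.1
    have hvL : MemLp (fun s => -(σ s * w s) - ρ ^ 2 * y.1 s) 2 (volume.restrict (Ioo 0 ℓ)) :=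
      hσw.neg.sub (hyL.const_mul _)
    rw [← hw0]
    -- On test functions the factored equation says w' = -σw - ρ²y in the weak sense, and a
    -- continuous function with integrable weak derivative is a primitive of it.
    refine eq_primitive_of_hasWeakDeriv hℓ hwc (memLp_two_intervalIntegrable hℓ.le hvL) ?_
    intro φ hφ
    have hd : ContDiff ℝ 1 φ := hφ.1.of_le (by exact_mod_cast le_top)
    have hdc := hd.continuous_deriv (by norm_num)
    set Φ : W12Zero ℓ := ⟨⟨φ, hφ.memW12 hℓ.le⟩,
      image_eq_zero_of_notMem_tsupport fun h => by simpa using hφ.2.2 h,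
      image_eq_zero_of_notMem_tsupport fun h => by simpa using hφ.2.2 h⟩ with hΦ
    have hΦd : weakDeriv Φ.1 =ᵐ[volume.restrict (Ioo 0 ℓ)] deriv φ :=
      weakDeriv_ae_eq_of_primitive hℓ _ (c := 0) (hdc.intervalIntegrable _ _)
        fun x _ => hφ.eq_primitive x
    have hφL := memLp_continuousOn (ℓ := ℓ) hd.continuous.continuousOn
    have i1 : Integrable (fun x => w x * deriv φ x) (volume.restrict (Ioo 0 ℓ)) :=
      (memLp_continuousOn hwc).integrable_mul (memLp_continuousOn hdc.continuousOn)
    have i2 : Integrable (fun x => σ x * w x * φ x) (volume.restrict (Ioo 0 ℓ)) :=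
      hσw.integrable_mul hφL
    have i3 : Integrable (fun x => ρ ^ 2 * (y.1 x * φ x)) (volume.restrict (Ioo 0 ℓ)) :=
      (hyL.integrable_mul hφL).const_mul _
    have e1 : schrodinger q y Φ =
        (∫ x in Ioo 0 ℓ, w x * deriv φ x) - ∫ x in Ioo 0 ℓ, σ x * w x * φ x := by
      rw [schrodinger_eq_integral_darbouxDeriv hℓ hf, ← integral_sub i1 i2]
      refine integral_congr_ae ?_
      filter_upwards [hwD, hσf, hΦd] with x h3 h4 h5
      rw [← h3, ← h4, h5]
      ring
    have e2 : ∫ x in Ioo 0 ℓ, (-(σ x * w x) - ρ ^ 2 * y.1 x) * φ x =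
        -((∫ x in Ioo 0 ℓ, σ x * w x * φ x) + ρ ^ 2 * ∫ x in Ioo 0 ℓ, y.1 x * φ x) := by
      rw [← integral_const_mul, ← integral_add i2 i3, ← integral_neg]
      congr 1 with x
      ring
    have e3 := hsol Φ
    rw [e1] at e3
    rw [e2]
    linear_combination e3

/-- Uniqueness of exponential solutions. -/
theorem IsExponentialSolution.eqOn {ℓ : ℝ} (hℓ : 0 < ℓ) {q : WNeg12 ℓ} {f : W12 ℓ}
    (hf : IsNonvanishingSolution q f) {σ : ℝ → ℂ}
    (h2 : MemLp σ 2 (volume.restrict (Ioo 0 ℓ)))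
    (hσf : σ =ᵐ[volume.restrict (Ioo 0 ℓ)] fun x => weakDeriv f x / f.1 x) {ρ : ℂ}
    {y₁ y₂ : W12 ℓ} (h₁ : IsExponentialSolution q f ρ y₁) (h₂ : IsExponentialSolution q f ρ y₂) :
    EqOn y₁.1 y₂.1 (Icc 0 ℓ) := by
  obtain ⟨w₁, hw₁, hy₁, hv₁⟩ := h₁.exists_system hℓ hf h2 hσf
  obtain ⟨w₂, hw₂, hy₂, hv₂⟩ := h₂.exists_system hℓ hf h2 hσf
  have hσI := memLp_two_intervalIntegrable hℓ.le h2
  have hsub : ∀ {x}, x ∈ Icc 0 ℓ → uIcc 0 x ⊆ Icc 0 ℓ := fun hx => by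
    rw [uIcc_of_le hx.1]; exact Icc_subset_Icc_right hx.2
  have hc : ∀ {u : ℝ → ℂ}, ContinuousOn u (Icc 0 ℓ) → ∀ x ∈ Icc 0 ℓ,
      IntervalIntegrable u volume 0 x := fun hu x hx => (hu.mono (hsub hx)).intervalIntegrable
  have hσc : ∀ {u : ℝ → ℂ}, ContinuousOn u (Icc 0 ℓ) → ∀ x ∈ Icc 0 ℓ,
      IntervalIntegrable (fun s => σ s * u s) volume 0 x := fun hu x hx =>
    (hσI.mono_set (uIcc_subset_of_mem hx)).mul_continuousOn (hu.mono (hsub hx))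
  have hlin : ∀ {u v : ℝ → ℂ}, ContinuousOn u (Icc 0 ℓ) → ContinuousOn v (Icc 0 ℓ) →
      ∀ x ∈ Icc 0 ℓ, IntervalIntegrable (fun s => -(σ s * u s) - ρ ^ 2 * v s) volume 0 x :=
    fun hu hv x hx => (hσc hu x hx).neg.sub ((hc hv x hx).const_mul _)
  set d : ℝ → ℂ := fun x => y₁.1 x - y₂.1 x with hd
  set e : ℝ → ℂ := fun x => w₁ x - w₂ x with he
  have hdc : ContinuousOn d (Icc 0 ℓ) := y₁.2.1.sub y₂.2.1
  have hec : ContinuousOn e (Icc 0 ℓ) := hw₁.sub hw₂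
  have hde : ∀ x ∈ Icc 0 ℓ, d x = ∫ s in (0 : ℝ)..x, (σ s * d s + e s) := by
    intro x hx
    simp only [hd]
    rw [hy₁ x hx, hy₂ x hx, add_sub_add_left_eq_sub, ← intervalIntegral.integral_sub
      ((hσc y₁.2.1 x hx).add (hc hw₁ x hx)) ((hσc y₂.2.1 x hx).add (hc hw₂ x hx))]
    congr 1 with s
    simp only [he]
    ring
  have hee : ∀ x ∈ Icc 0 ℓ, e x = ∫ s in (0 : ℝ)..x, (-(σ s * e s) - ρ ^ 2 * d s) := by
    intro x hx
    simp only [he]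
    rw [hv₁ x hx, hv₂ x hx, add_sub_add_left_eq_sub, ← intervalIntegral.integral_sub
      (hlin hw₁ y₁.2.1 x hx) (hlin hw₂ y₂.2.1 x hx)]
    congr 1 with s
    simp only [hd]
    ring
  -- The coefficient ‖σ‖ + 1 + ‖ρ‖² dominates both rows of the system for the differences d and e.
  have hz := eq_zero_of_le_integral_mul hℓ (g := fun s => ‖σ s‖ + (1 + ‖ρ‖ ^ 2))
    (u := fun s => ‖d s‖ + ‖e s‖) (fun s => by positivity) (h2.norm.add (memLp_const _))
    (hdc.norm.add hec.norm) (fun x _ => by positivity) (fun x hx => by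
      have i1 := (hσc hdc x hx).add (hc hec x hx)
      have i2 := hlin hec hdc x hx
      have i3 : IntervalIntegrable (fun s => (‖σ s‖ + (1 + ‖ρ‖ ^ 2)) * (‖d s‖ + ‖e s‖))
          volume 0 x := by
        refine IntervalIntegrable.mul_continuousOn ?_ ((hdc.norm.add hec.norm).mono (hsub hx))
        exact (hσI.mono_set (uIcc_subset_of_mem hx)).norm.add (by simp)
      have n1 := intervalIntegral.norm_integral_le_integral_norm
        (f := fun s => σ s * d s + e s) (μ := volume) hx.1
      have n2 := intervalIntegral.norm_integral_le_integral_norm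
        (f := fun s => -(σ s * e s) - ρ ^ 2 * d s) (μ := volume) hx.1
      rw [← hde x hx] at n1
      rw [← hee x hx] at n2
      refine (add_le_add n1 n2).trans ?_
      rw [← intervalIntegral.integral_add i1.norm i2.norm]
      refine intervalIntegral.integral_mono_on hx.1 (i1.norm.add i2.norm) i3 fun s _ => ?_
      have m1 : ‖σ s * d s + e s‖ ≤ ‖σ s‖ * ‖d s‖ + ‖e s‖ := by
        rw [← norm_mul]; exact norm_add_le _ _
      have m2 : ‖-(σ s * e s) - ρ ^ 2 * d s‖ ≤ ‖σ s‖ * ‖e s‖ + ‖ρ‖ ^ 2 * ‖d s‖ := by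
        refine (norm_sub_le _ _).trans_eq ?_
        rw [norm_neg, norm_mul, norm_mul, norm_pow]
      have m3 : 0 ≤ ‖d s‖ := norm_nonneg _
      have m4 : 0 ≤ ‖ρ‖ ^ 2 * ‖e s‖ := by positivity
      linarith)
  intro x hx
  have h3 := hz x hx
  have h4 : ‖d x‖ = 0 := by linarith [norm_nonneg (d x), norm_nonneg (e x)]
  exact sub_eq_zero.1 (norm_eq_zero.1 h4)

end DistributionalSchrodinger

/-! ### The integral representation of the exponential solution -/

open DistributionalSchrodinger in
theorem mainTheorem1 (ℓ : ℝ) (hℓ : 0 < ℓ)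
    (q : DistributionalSchrodinger.WNeg12 ℓ) (f : DistributionalSchrodinger.W12 ℓ)
    (hf : DistributionalSchrodinger.IsNonvanishingSolution q f) (hf0 : f.1 0 = 1) :
    ∃ K : ℝ × ℝ → ℂ,
      MemLp K 2 (volume.restrict (DistributionalSchrodinger.triangle ℓ)) ∧
      (∀ x ∈ Ioo 0 ℓ, IntervalIntegrable (fun t => K (x, t)) volume (-x) x) ∧
      ∀ ρ : ℂ,
        (∃ y, DistributionalSchrodinger.IsExponentialSolution q f ρ y) ∧
        ∀ y, DistributionalSchrodinger.IsExponentialSolution q f ρ y →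
          ∀ x ∈ Ioo 0 ℓ,
            y.1 x = Complex.exp (Complex.I * ρ * x) +
              ∫ t in (-x)..x, K (x, t) * Complex.exp (Complex.I * ρ * t) := by
  obtain ⟨σ, hσ, h1, h2, hσf⟩ := exists_measurable_logDeriv f hf.2
  have h2r : MemLp σ 2 (volume.restrict (Ioo 0 ℓ)) := h2.restrict _
  have hKI : ∀ (ρ : ℂ) b x, x ≤ ℓ →
      Integrable (fun t => kernel σ b (x, t) * Complex.exp (Complex.I * ρ * t)) := by
    intro ρ b x hx
    obtain ⟨C, hC⟩ := exists_kernel_exp_bound hσ h1 h2 ℓ ρ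
    exact (hC b x hx).1
  -- As y = a + b, the kernel is the sum of the two components; it is built from σ alone, hence
  -- independent of ρ.
  refine ⟨fun p => kernel σ true p + kernel σ false p,
    (memLp_kernel_triangle hσ h2 ℓ true).add (memLp_kernel_triangle hσ h2 ℓ false),
    fun x hx => ?_, fun ρ => ?_⟩
  -- At ρ = 0 the exponential is 1, which leaves integrability of the kernel itself.
  · have := fun b => hKI 0 b x hx.2.le
    simp only [mul_zero, zero_mul, Complex.exp_zero, mul_one] at this
    exact ((this true).add (this false)).intervalIntegrable
  · obtain ⟨y, z, hyc, hzc, hy, hz, hyK⟩ := exists_dirac_solution hσ h1 h2 hℓ.le ρ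
    obtain ⟨Y, hYy, hY⟩ := isExponentialSolution_of_dirac hℓ hf h2r hσf hyc hzc hy hz
    refine ⟨⟨Y, hY⟩, fun u hu x hx => ?_⟩
    rw [hu.eqOn hℓ hf h2r hσf hY (Ioo_subset_Icc_self hx), hYy, hyK,
      kernelTransform_eq_intervalIntegral ρ true hx.1.le,
      kernelTransform_eq_intervalIntegral ρ false hx.1.le,
      ← intervalIntegral.integral_add (hKI ρ true x hx.2.le).intervalIntegrable
        (hKI ρ false x hx.2.le).intervalIntegrable]
    simp only [add_mul]
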